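/- Fix an integer $T\ge 3$, a variance $\sigma^2>0$ and $e\in\mathbb R$. Let the data be generated by the panel AR(1) model $y_{i,t}=\rho y_{i,t-1}+(1-\rho)\mu_i+\varepsilon_{i,t}$, $i=1,2,\dots$, $t=2,\dots,T$, with true value $\rho=1$ (so that $y_{i,t}=y_{i,t-1}+\varepsilon_{i,t}$), where the errors $\varepsilon_{i,t}$ are i.i.d. $N(0,\sigma^2)$ over $i$ and $t=2,\dots,T$; nothing is assumed about $\mu_i$ and $y_{i,1}$. Let $\Delta y_i=(y_{i,2}-y_{i,1},\dots,y_{i,T}-y_{i,T-1})'$, and for $r\in\mathbb R$ let $D_r$ be the $(T-1)\times(T-1)$ matrix with ones on the diagonal, $-r$ on the first subdiagonal and zeros elsewhere. Let $\mathrm{vech}$ stack the columns of the lower triangular part (diagonal included) of a square matrix, let $p=\frac12T(T-1)-2$, and let $P=(0\;\;g\;\;I_p)$ be the $p\times\frac12T(T-1)$ matrix in which the $p$-vector $g$ is given by $(1,-1,g')'=\mathrm{vech}(D_1D_1')$. Put $$m_i(r)=P\,\mathrm{vech}\bigl(D_r\,\Delta y_i(\Delta y_i)'D_r'\bigr),\qquad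 m(r)=\frac1N\sum_{i=1}^N m_i(r),\qquad \mathrm{AR}_N(r)=N\,m(r)'\,\widehat V(r)^{-1}m(r),$$ where $\widehat V(r)$ is the Eicker--White covariance estimator, either uncentered, $\widehat V(r)=\frac1N\sum_{i=1}^N m_i(r)m_i(r)'$, or centered, $\widehat V(r)=\frac1N\sum_{i=1}^N(m_i(r)-m(r))(m_i(r)-m(r))'$ (with an arbitrary convention for the inverse when $\widehat V(r)$ is singular). Then, for either choice of $\widehat V$, the GMM Anderson--Rubin statistic for testing $H_0:\rho=a_N=1-e/N^{1/4}$ satisfies, as $N\to\infty$ with $T$ fixed, $$\mathrm{AR}_N\bigl(1-e/N^{1/4}\bigr)\;\xrightarrow{d}\;\chi^2(\delta_e,p),\qquad \delta_e=e^4\,\frac{(2T-3)T(T-1)(T-2)}{72},$$ where $\chi^2(\delta,p)$ denotes the noncentral chi-square distribution with $p$ degrees of freedom and noncentrality $\delta$, i.e. the law of $\sum_{j=1}^p(Z_j+a_j)^2$ with $Z_1,\dots,Z_p$ i.i.d. $N(0,1)$ and $\sum_{j=1}^p a_j^2=\delta$. In particular $\delta_e=\frac{(2T-3)T(T-1)(T-2)}{72}$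 for $e=1$. -/

import Mathlib

open MeasureTheory ProbabilityTheory Filter
open scoped NNReal Matrix

/-- The non-central chi-square distribution `χ²(δ, p)` with noncentrality `δ ≥ 0` and `p ≥ 1` degrees
of freedom: the law of `∑ j, (Z j + a j) ^ 2` with `Z 1, …, Z p` independent standard normal variables
and `∑ j, a j ^ 2 = δ`. This law depends on the vector `a` only through `δ`; all entries of `a` are
taken equal to `√(δ / p)` here. -/
noncomputable def noncentralChiSquared (δ : ℝ) (p : ℕ) : Measure ℝ :=
  (Measure.pi fun _ : Fin p => gaussianReal 0 1).map
    fun z => ∑ j, (z j + √(δ / (p : ℝ))) ^ 2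

instance (δ : ℝ) (p : ℕ) : IsProbabilityMeasure (noncentralChiSquared δ p) :=
  Measure.isProbabilityMeasure_map (Measurable.aemeasurable (by fun_prop))

/-- The panel AR(1) model with individual effects:
`y i t = ρ * y i (t - 1) + η i + ε i t` with `η i = (1 - ρ) * μ i`, for the periods `t = 2, …, T`.
The observations of individual `i` are `y i 1, …, y i T`. -/
def IsPanelAR1 {Ω : Type*} (T : ℕ) (ρ : ℝ) (μ : ℕ → Ω → ℝ) (ε y : ℕ → ℕ → Ω → ℝ) : Prop :=
  ∀ i t ω, 2 ≤ t → t ≤ T → y i t ω = ρ * y i (t - 1) ω + (1 - ρ) * μ i ω + ε i t ω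

/-- The errors `ε i t`, `i = 0, 1, 2, …`, `t = 2, …, T`, are i.i.d. `N(0, v)`. -/
structure IIDNormalErrors {Ω : Type*} [MeasurableSpace Ω] (P : Measure Ω) (T : ℕ) (v : ℝ≥0)
    (ε : ℕ → ℕ → Ω → ℝ) : Prop where
  law : ∀ i, ∀ t ∈ Finset.Icc 2 T, HasLaw (ε i t) (gaussianReal 0 v) P
  indep : iIndepFun (fun (q : ℕ × Finset.Icc 2 T) => ε q.1 q.2) P

/-- Positions `(k, l)` with `l ≤ k`, i.e. on or below the diagonal of an `n × n` matrix. -/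
abbrev VechIdx (n : ℕ) : Type := {q : Fin n × Fin n // q.2 ≤ q.1}

/-- The half-vectorization of a square matrix: its entries on and below the diagonal. -/
def vech {n : ℕ} (A : Matrix (Fin n) (Fin n) ℝ) : VechIdx n → ℝ := fun q => A q.1.1 q.1.2

/-- The positions that remain in `vech` after its first two entries, at `(1, 1)` and `(2, 1)`
(here `(0, 0)` and `(1, 0)`), have been removed. -/
abbrev MomentIdx (n : ℕ) : Type :=
  {q : VechIdx n // ¬ (q.1.1.val = 0 ∧ q.1.2.val = 0) ∧ ¬ (q.1.1.val = 1 ∧ q.1.2.val = 0)}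

/-- The band matrix `D_r` with ones on the diagonal and `-r` on the first subdiagonal. -/
def bandMatrix (n : ℕ) (r : ℝ) : Matrix (Fin n) (Fin n) ℝ :=
  Matrix.of fun k l => if k = l then 1 else if k.val = l.val + 1 then -r else 0

/-- The matrix `P = (0  g  I)`, where `(1, -1, g')' = vech (D₁ D₁')`. -/
def selectionMatrix (n : ℕ) : Matrix (MomentIdx n) (VechIdx n) ℝ :=
  Matrix.of fun a q =>
    if q.1.1.val = 0 ∧ q.1.2.val = 0 then 0
    else if q.1.1.val = 1 ∧ q.1.2.val = 0 then vech (bandMatrix n 1 * (bandMatrix n 1)ᵀ) a.1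
    else if q = a.1 then 1 else 0

section Statistic

variable {Ω : Type*}

/-- The vector of first differences `Δy i = (y i 2 - y i 1, …, y i T - y i (T - 1))`. -/
def firstDiff (T : ℕ) (y : ℕ → ℕ → Ω → ℝ) (i : ℕ) (ω : Ω) : Fin (T - 1) → ℝ :=
  fun j => y i (j.val + 2) ω - y i (j.val + 1) ω

/-- The contribution `P vech (D_r Δy Δy' D_r')` of individual `i` to the moment vector. -/
noncomputable def momentContribution (T : ℕ) (y : ℕ → ℕ → Ω → ℝ) (r : ℝ) (i : ℕ) (ω : Ω) :
    MomentIdx (T - 1) → ℝ :=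
  selectionMatrix (T - 1) *ᵥ
    vech (bandMatrix (T - 1) r * Matrix.vecMulVec (firstDiff T y i ω) (firstDiff T y i ω) *
      (bandMatrix (T - 1) r)ᵀ)

/-- The sample moment vector `m(r)` of the first `N` individuals. -/
noncomputable def sampleMoment (T : ℕ) (y : ℕ → ℕ → Ω → ℝ) (N : ℕ) (r : ℝ) (ω : Ω) :
    MomentIdx (T - 1) → ℝ :=
  (N : ℝ)⁻¹ • ∑ i ∈ Finset.range N, momentContribution T y r i ω

/-- The Eicker-White covariance estimator `N⁻¹ ∑ mᵢ(r) mᵢ(r)'`. -/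
noncomputable def eickerWhite (T : ℕ) (y : ℕ → ℕ → Ω → ℝ) (N : ℕ) (r : ℝ) (ω : Ω) :
    Matrix (MomentIdx (T - 1)) (MomentIdx (T - 1)) ℝ :=
  (N : ℝ)⁻¹ • ∑ i ∈ Finset.range N,
    Matrix.vecMulVec (momentContribution T y r i ω) (momentContribution T y r i ω)

/-- The centered Eicker-White covariance estimator `N⁻¹ ∑ (mᵢ(r) - m(r)) (mᵢ(r) - m(r))'`. -/
noncomputable def eickerWhiteCentered (T : ℕ) (y : ℕ → ℕ → Ω → ℝ) (N : ℕ) (r : ℝ) (ω : Ω) :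
    Matrix (MomentIdx (T - 1)) (MomentIdx (T - 1)) ℝ :=
  (N : ℝ)⁻¹ • ∑ i ∈ Finset.range N,
    Matrix.vecMulVec (momentContribution T y r i ω - sampleMoment T y N r ω)
      (momentContribution T y r i ω - sampleMoment T y N r ω)

/-- The GMM Anderson-Rubin statistic `N m(r)' V(r)⁻¹ m(r)`, for a covariance estimator `V`. -/
noncomputable def gmmAR (T : ℕ) (y : ℕ → ℕ → Ω → ℝ)
    (V : ℕ → ℝ → Ω → Matrix (MomentIdx (T - 1)) (MomentIdx (T - 1)) ℝ)
    (N : ℕ) (r : ℝ) (ω : Ω) : ℝ :=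
  (N : ℝ) * (sampleMoment T y N r ω ⬝ᵥ ((V N r ω)⁻¹ *ᵥ sampleMoment T y N r ω))

end Statistic

/-!
Write `n = T - 1`, `h = 1 - r` and `D_r = D₁ + h L`, where `L` is the matrix with ones on the
first subdiagonal. Under a unit root the vectors of first differences `x` are i.i.d. `N(0, v I)`,
and every entry of the moment vector is a quadratic form `x' D_r' Φ D_r x`, hence a quadratic
polynomial `F₀ + h F₁ + h² F₂` in `h` whose coefficients are quadratic forms in `x`. The vector
`g` is such that `F₀` and `F₁` have mean zero, while `F₂` has mean `v d`, with `d` the indicator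
of the diagonal positions. At `h = e / N ^ (1/4)` the sum of the `F₀` over `√N` obeys the central
limit theorem, the `F₁` term vanishes since `h → 0`, and the `F₂` term converges to `e² v d` by
the law of large numbers, because `√N h² = e²`. Both covariance estimators converge almost surely
to `V = E[F₀ F₀']`. Slutsky's theorem then gives the limit law of the statistic, namely that of
`y' V⁻¹ y` for `y` Gaussian with mean `e² v d` and covariance `V`
(`tendstoInDistribution_andersonRubin`); by rotation invariance it is the non-central chi-square
law with noncentrality `e⁴ v² d' V⁻¹ d` (`map_quadraticForm_multivariateGaussian`).

For the value of `d' V⁻¹ d`, Isserlis' formula turns covariances of quadratic forms into traces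
(`integral_dotProduct_mulVec_mul`). The combinations of the entries of `F₀` are the forms `x' Q x`
with `Q` symmetric, of trace zero and with entries that sum to zero, the inner product being
`2 v² tr (Q Q')`. On this space, pairing with `d` is pairing with the matrix `M = (D₁' D₁)⁻¹`, whose
entries are `min k l`, so that `V⁻¹ d` comes from the projection of `M`, which is
`M - (n + 1) / 6 • I - (n + 1) / 3 • J` (`projectedMatrix`, `exists_mulVec_eq`). The remaining sums of minima are
explicit (`noncentrality_eq`).
-/

/-! ### Second moments and the multivariate central limit theorem -/

/-- The matrix `∫ F F' dν` of second moments of a random vector `F` under `ν`. -/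
noncomputable def secondMomentMatrix {S ι : Type*} [MeasurableSpace S] (ν : Measure S)
    (F : S → ι → ℝ) : Matrix ι ι ℝ :=
  Matrix.of fun a b => ∫ x, F x a * F x b ∂ν

section Limit

variable {Ω S ι : Type*} [MeasurableSpace Ω] [MeasurableSpace S] [Fintype ι]
  {P : Measure Ω} [IsProbabilityMeasure P] {ν : Measure S} {X : ℕ → Ω → S} {F : S → ι → ℝ}

lemma dotProduct_secondMomentMatrix_mulVec (hL2 : ∀ a, MemLp (fun x => F x a) 2 ν) (s t : ι → ℝ) :
    s ⬝ᵥ secondMomentMatrix ν F *ᵥ t = ∫ x, (s ⬝ᵥ F x) * (t ⬝ᵥ F x) ∂ν := by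
  have hint : ∀ a b, Integrable (fun x => F x a * F x b) ν := fun a b =>
    (hL2 a).integrable_mul (hL2 b)
  have : ∀ x, (s ⬝ᵥ F x) * (t ⬝ᵥ F x) = ∑ a, ∑ b, s a * t b * (F x a * F x b) := by
    intro x
    simp only [dotProduct, Finset.sum_mul_sum]
    exact Finset.sum_congr rfl fun a _ => Finset.sum_congr rfl fun b _ => by ring
  simp_rw [this]
  rw [integral_finsetSum _ fun a _ => integrable_finsetSum _ fun b _ => (hint a b).const_mul _]
  simp only [dotProduct, Matrix.mulVec, secondMomentMatrix, Matrix.of_apply, Finset.mul_sum]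
  refine Finset.sum_congr rfl fun a _ => ?_
  rw [integral_finsetSum _ fun b _ => (hint a b).const_mul _]
  refine Finset.sum_congr rfl fun b _ => ?_
  rw [integral_const_mul]
  ring

lemma isHermitian_secondMomentMatrix {ι : Type*} {F : S → ι → ℝ} :
    (secondMomentMatrix ν F).IsHermitian := by
  ext a b
  simp [secondMomentMatrix, mul_comm]

lemma posSemidef_secondMomentMatrix (hL2 : ∀ a, MemLp (fun x => F x a) 2 ν) :
    (secondMomentMatrix ν F).PosSemidef := by
  refine Matrix.PosSemidef.of_dotProduct_mulVec_nonneg isHermitian_secondMomentMatrix fun t => ?_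
  rw [star_trivial, dotProduct_secondMomentMatrix_mulVec hL2]
  exact integral_nonneg fun x => mul_self_nonneg _

/-- Multivariate central limit theorem for centred, square-integrable functions of an i.i.d.
sequence. By Lévy's theorem it reduces to the one-dimensional theorem for the projections on fixed
vectors. -/
theorem tendstoInDistribution_inv_sqrt_smul_sum [DecidableEq ι] (hX : ∀ i, HasLaw (X i) ν P)
    (hind : iIndepFun X P) (hF : Measurable F) (hL2 : ∀ a, MemLp (fun x => F x a) 2 ν)
    (h0 : ∀ a, ∫ x, F x a ∂ν = 0) :
    TendstoInDistribution
      (fun (N : ℕ) ω => WithLp.toLp 2 ((√(N : ℝ))⁻¹ • ∑ i ∈ Finset.range N, F (X i ω)))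
      atTop id (fun _ => P) (multivariateGaussian 0 (secondMomentMatrix ν F)) := by
  have hmeas : ∀ N : ℕ, AEMeasurable
      (fun ω => WithLp.toLp 2 ((√(N : ℝ))⁻¹ • ∑ i ∈ Finset.range N, F (X i ω))) P := by
    intro N
    have : ∀ i, AEMeasurable (fun ω => F (X i ω)) P := fun i =>
      hF.comp_aemeasurable (hX i).aemeasurable
    refine (WithLp.measurable_toLp 2 _).comp_aemeasurable ?_
    exact (Finset.aemeasurable_fun_sum (f := fun i ω => F (X i ω)) _ fun i _ => this i).const_smul
      (√(N : ℝ))⁻¹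
  refine ⟨hmeas, by fun_prop, ?_⟩
  refine ProbabilityMeasure.tendsto_iff_tendsto_charFun.2 fun t => ?_
  -- the projection on `t`, to which the one-dimensional theorem applies
  set f : S → ℝ := fun x => t.ofLp ⬝ᵥ F x with hf
  have hfm : Measurable f := by
    simp only [hf, dotProduct]
    fun_prop
  have hfL2 : MemLp f 2 ν := by
    simp only [hf, dotProduct]
    exact memLp_finsetSum _ fun a _ => (hL2 a).const_mul _
  have : IsProbabilityMeasure ν := (hX 0).isProbabilityMeasure_iff.1 inferInstance
  have hf0 : ∫ x, f x ∂ν = 0 := by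
    simp only [hf, dotProduct]
    rw [integral_finsetSum _ fun a _ => ((hL2 a).integrable (by norm_num)).const_mul _]
    simp [integral_const_mul, h0]
  have hmean : P[f ∘ X 0] = 0 := by
    rw [(hX 0).integral_comp hfm.aestronglyMeasurable, hf0]
  have hvar : Var[f ∘ X 0; P] = t.ofLp ⬝ᵥ secondMomentMatrix ν F *ᵥ t.ofLp := by
    rw [variance_of_integral_eq_zero (hfm.comp_aemeasurable (hX 0).aemeasurable) hmean,
      dotProduct_secondMomentMatrix_mulVec hL2]
    have := (hX 0).integral_comp (f := fun x => f x * f x) (by fun_prop)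
    rw [← this]
    simp [pow_two]
  have hident : ∀ i, IdentDistrib (f ∘ X i) (f ∘ X 0) P P := fun i =>
    ((hX i).identDistrib (hX 0)).comp hfm
  have hclt := tendstoInDistribution_inv_sqrt_mul_sum_sub (X := fun i => f ∘ X i) (P := P)
    (Y := id) (P' := gaussianReal 0 Var[f ∘ X 0; P].toNNReal) ⟨by fun_prop, Measure.map_id⟩
    (((hX 0).map_eq ▸ hfL2).comp_of_map (hX 0).aemeasurable)
    (hind.comp (fun _ => f) fun _ => hfm) hident
  have hch := ProbabilityMeasure.tendsto_iff_tendsto_charFun.1 hclt.tendsto 1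
  convert hch using 2 with N
  · simp only [ProbabilityMeasure.coe_mk]
    rw [charFun_apply, charFun_apply, integral_map (hmeas N) (by fun_prop),
      integral_map (hclt.forall_aemeasurable N) (by fun_prop)]
    refine integral_congr_ae (ae_of_all _ fun ω => ?_)
    simp only [hmean, mul_zero, sub_zero]
    congr 3
    simp only [EuclideanSpace.inner_eq_star_dotProduct, star_trivial, hf, Function.comp_apply,
      ← dotProduct_sum, dotProduct_smul, smul_eq_mul]
    simp
  · simp only [ProbabilityMeasure.coe_mk, Measure.map_id]
    rw [charFun_multivariateGaussian (posSemidef_secondMomentMatrix hL2), charFun_gaussianReal,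
      ← hvar, Real.coe_toNNReal _ (variance_nonneg _ _)]
    simp

end Limit

/-! ### Quadratic forms in Gaussian vectors, the strong law, and inverse matrices -/

section QuadraticForm

variable {ι : Type*} [Fintype ι]

/-- The law of `‖x + a‖²` for a standard Gaussian vector `x` depends on `a` only through its
norm: an isometry moves `a` to the vector with equal entries that defines
`noncentralChiSquared`. -/
lemma map_norm_add_sq_stdGaussian [Nonempty ι] (a : EuclideanSpace ℝ ι) :
    (stdGaussian (EuclideanSpace ℝ ι)).map (fun x => ‖x + a‖ ^ 2) =
      noncentralChiSquared (‖a‖ ^ 2) (Fintype.card ι) := by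
  set p := Fintype.card ι
  have hp : (0 : ℝ) < p := by exact_mod_cast Fintype.card_pos
  let U : EuclideanSpace ℝ ι ≃ₗᵢ[ℝ] EuclideanSpace ℝ (Fin p) :=
    LinearIsometryEquiv.piLpCongrLeft 2 ℝ ℝ (Fintype.equivFin ι)
  let b : EuclideanSpace ℝ (Fin p) := WithLp.toLp 2 fun _ => √(‖a‖ ^ 2 / p)
  have hb : ‖U a‖ = ‖b‖ := by
    have h : ‖b‖ ^ 2 = ‖a‖ ^ 2 := by
      rw [EuclideanSpace.real_norm_sq_eq]
      simp only [b]
      rw [Finset.sum_congr rfl fun _ _ => Real.sq_sqrt (by positivity)]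
      simp [mul_div_cancel₀ _ hp.ne']
    rw [U.norm_map]
    exact (sq_eq_sq₀ (norm_nonneg _) (norm_nonneg _)).1 h.symm
  let W : EuclideanSpace ℝ ι ≃ₗᵢ[ℝ] EuclideanSpace ℝ (Fin p) :=
    U.trans (ℝ ∙ (U a - b))ᗮ.reflection
  have hW : W a = b := Submodule.reflection_sub hb
  have h1 : (fun x : EuclideanSpace ℝ ι => ‖x + a‖ ^ 2) = (fun y => ‖y + b‖ ^ 2) ∘ W := by
    ext x
    simp only [Function.comp_apply]
    rw [← hW, ← map_add, W.norm_map]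
  rw [h1, ← Measure.map_map (by fun_prop) W.continuous.measurable, stdGaussian_map,
    ← map_pi_eq_stdGaussian, Measure.map_map (by fun_prop) (by fun_prop), noncentralChiSquared]
  congr 1
  ext z
  simp [EuclideanSpace.real_norm_sq_eq, b]

open scoped MatrixOrder in
/-- If `y` is Gaussian with mean `c` and invertible covariance matrix `V`, then `y' V⁻¹ y` has a
non-central chi-square law, with noncentrality `c' V⁻¹ c`. -/
theorem map_quadraticForm_multivariateGaussian [Nonempty ι] [DecidableEq ι] {V : Matrix ι ι ℝ}
    (hV : V.PosDef) (c : ι → ℝ) :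
    (multivariateGaussian 0 V).map (fun z => (z.ofLp + c) ⬝ᵥ V⁻¹ *ᵥ (z.ofLp + c)) =
      noncentralChiSquared (c ⬝ᵥ V⁻¹ *ᵥ c) (Fintype.card ι) := by
  set R := CFC.sqrt V
  have hRR : R * R = V := CFC.sqrt_mul_sqrt_self V hV.posSemidef.nonneg
  have hRt : Rᵀ = R := by
    have := (CFC.sqrt_nonneg V).isSelfAdjoint
    rwa [isSelfAdjoint_iff, Matrix.star_eq_conjTranspose,
      Matrix.conjTranspose_eq_transpose_of_trivial] at this
  have hdet : IsUnit R.det := by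
    have h := (Matrix.isUnit_iff_isUnit_det _).1 hV.isUnit
    rw [← hRR, Matrix.det_mul] at h
    exact isUnit_of_mul_isUnit_left h
  have hone : Rᵀ * V⁻¹ * R = 1 := by
    rw [hRt, ← hRR, Matrix.mul_inv_rev, ← mul_assoc, Matrix.mul_nonsing_inv _ hdet, one_mul,
      Matrix.nonsing_inv_mul _ hdet]
  have hquad : ∀ y : ι → ℝ, (R *ᵥ y) ⬝ᵥ V⁻¹ *ᵥ (R *ᵥ y) = ‖WithLp.toLp 2 y‖ ^ 2 := by
    intro y
    rw [Matrix.mulVec_mulVec, ← Matrix.vecMul_transpose R, ← Matrix.dotProduct_mulVec,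
      Matrix.mulVec_mulVec, ← mul_assoc, hone, Matrix.one_mulVec, EuclideanSpace.real_norm_sq_eq]
    simp [dotProduct, pow_two]
  set a : ι → ℝ := R⁻¹ *ᵥ c
  have ha : R *ᵥ a = c := by
    rw [Matrix.mulVec_mulVec, Matrix.mul_nonsing_inv _ hdet, Matrix.one_mulVec]
  rw [multivariateGaussian, Measure.map_map (by simp only [dotProduct, Matrix.mulVec]; fun_prop)
    (by fun_prop), ← ha, hquad a, ← map_norm_add_sq_stdGaussian]
  congr 1
  ext x
  simp only [Function.comp_apply, zero_add, Matrix.ofLp_toEuclideanCLM]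
  rw [← Matrix.mulVec_add, hquad]
  rfl

end QuadraticForm

section Tools

variable {Ω S : Type*} [MeasurableSpace Ω] [MeasurableSpace S]
  {P : Measure Ω} {ν : Measure S} {X : ℕ → Ω → S}

/-- Strong law of large numbers for an integrable function of an i.i.d. sequence. -/
lemma ae_tendsto_average (hX : ∀ i, HasLaw (X i) ν P)
    (hind : iIndepFun X P) {f : S → ℝ} (hf : Measurable f) (hint : Integrable f ν) :
    ∀ᵐ ω ∂P, Tendsto (fun N : ℕ => (N : ℝ)⁻¹ * ∑ i ∈ Finset.range N, f (X i ω)) atTop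
      (nhds (∫ x, f x ∂ν)) := by
  have h := strong_law_ae_real (fun i => f ∘ X i)
    (((hX 0).map_eq ▸ hint).comp_aemeasurable (hX 0).aemeasurable)
    (fun i j hij => (hind.indepFun hij).comp hf hf)
    fun i => ((hX i).identDistrib (hX 0)).comp hf
  rw [(hX 0).integral_comp hf.aestronglyMeasurable] at h
  filter_upwards [h] with ω hω
  simpa [div_eq_inv_mul] using hω

lemma aemeasurable_matrix_inv_apply {ι : Type*} [Fintype ι] [DecidableEq ι] {W : Ω → Matrix ι ι ℝ}
    (hW : ∀ a b, AEMeasurable (fun ω => W ω a b) P) (a b : ι) :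
    AEMeasurable (fun ω => (W ω)⁻¹ a b) P := by
  have h1 : AEMeasurable (fun ω => (fun a b => W ω a b : ι → ι → ℝ)) P :=
    aemeasurable_pi_lambda _ fun a => aemeasurable_pi_lambda _ fun b => hW a b
  have hdet : Continuous fun A : ι → ι → ℝ => (Matrix.of A).det :=
    Continuous.matrix_det (A := fun A : ι → ι → ℝ => Matrix.of A) continuous_id
  have hadj : Continuous fun A : ι → ι → ℝ => (Matrix.of A).adjugate a b :=
    ((Continuous.matrix_adjugate (A := fun A : ι → ι → ℝ => Matrix.of A) continuous_id)).matrix_elem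
      a b
  have := (hdet.measurable.inv.mul hadj.measurable).comp_aemeasurable h1
  refine this.congr (ae_of_all _ fun ω => ?_)
  simp only [Function.comp_apply, Pi.mul_apply, Pi.inv_apply, Matrix.inv_def,
    Ring.inverse_eq_inv', Matrix.smul_apply, smul_eq_mul]
  rfl

lemma tendsto_matrix_inv {α ι : Type*} [Fintype ι] [DecidableEq ι] {l : Filter α}
    {W : α → Matrix ι ι ℝ} {V : Matrix ι ι ℝ} (hV : V.PosDef)
    (hW : ∀ a b, Tendsto (fun k => W k a b) l (nhds (V a b))) (a b : ι) :
    Tendsto (fun k => (W k)⁻¹ a b) l (nhds (V⁻¹ a b)) := by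
  have h : Tendsto W l (nhds V) := tendsto_pi_nhds.2 fun a => tendsto_pi_nhds.2 fun b => hW a b
  have hc : ContinuousAt Inv.inv V := by
    refine continuousAt_matrix_inv V ?_
    have := ((Matrix.isUnit_iff_isUnit_det _).1 hV.isUnit).ne_zero
    simpa [Ring.inverse_eq_inv'] using continuousAt_inv₀ this
  have := hc.tendsto.comp h
  exact tendsto_pi_nhds.1 (tendsto_pi_nhds.1 this a) b

lemma TendstoInDistribution.of_map_eq {E Ω' : Type*} [TopologicalSpace E] [MeasurableSpace E]
    [OpensMeasurableSpace E] [MeasurableSpace Ω'] {μ' : Measure Ω'} [IsProbabilityMeasure μ']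
    [IsProbabilityMeasure P] {κ : Measure E} [IsProbabilityMeasure κ] {Y : ℕ → Ω → E} {Z : Ω' → E}
    (h : TendstoInDistribution Y atTop Z (fun _ => P) μ') (hZ : μ'.map Z = κ) :
    TendstoInDistribution Y atTop id (fun _ => P) κ := by
  refine ⟨h.forall_aemeasurable, by fun_prop, ?_⟩
  convert h.tendsto using 3
  simp [hZ]

end Tools

/-! ### Anderson-Rubin statistics under a quadratic drift -/

section AndersonRubin

variable {Ω S ι : Type*} [MeasurableSpace Ω] [MeasurableSpace S] [Fintype ι]
  {P : Measure Ω} {ν : Measure S} {X : ℕ → Ω → S}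
  {F : Fin 3 → S → ι → ℝ} {h : ℕ → ℝ}

/-- The three terms of `√N` times the sample moment, at a given drift `h`. Both sides vanish for
`N = 0`. -/
lemma sqrt_smul_average_eq {ι : Type*} (z : ℕ → Fin 3 → ι → ℝ) (h : ℝ) (N : ℕ) (a : ι) :
    √(N : ℝ) * ((N : ℝ)⁻¹ • ∑ i ∈ Finset.range N, ∑ j : Fin 3, h ^ (j : ℕ) • z i j) a =
      ((√(N : ℝ))⁻¹ • ∑ i ∈ Finset.range N, z i 0) a +
        h * ((√(N : ℝ))⁻¹ • ∑ i ∈ Finset.range N, z i 1) a +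
        √(N : ℝ) * h ^ 2 * ((N : ℝ)⁻¹ * ∑ i ∈ Finset.range N, z i 2 a) := by
  have hN : (√(N : ℝ))⁻¹ = √(N : ℝ) * (N : ℝ)⁻¹ := by
    rw [← div_eq_mul_inv, Real.sqrt_div_self', one_div]
  simp only [hN, Fin.sum_univ_three, Pi.smul_apply, Finset.sum_apply, Pi.add_apply, smul_eq_mul,
    Finset.sum_add_distrib, ← Finset.mul_sum, Fin.val_zero, Fin.val_one, Fin.val_two, pow_zero,
    pow_one]
  ring

/-- Asymptotic law of an Anderson-Rubin statistic whose moments `F 0 + h F 1 + h² F 2` are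
quadratic in a drift `h` of order `N ^ (-1/4)`. The term `F 0` satisfies the central limit
theorem, `h F 1` is negligible because `F 1` is centred, and `h² F 2` is of the same order as the
standard error, so that its mean becomes the noncentrality vector. -/
theorem tendstoInDistribution_andersonRubin [IsProbabilityMeasure P] [DecidableEq ι] [Nonempty ι]
    (hX : ∀ i, HasLaw (X i) ν P) (hind : iIndepFun X P) (hF : ∀ j, Measurable (F j))
    (hL2 : ∀ j a, MemLp (fun x => F j x a) 2 ν) (h0 : ∀ a, ∫ x, F 0 x a ∂ν = 0)
    (h1 : ∀ a, ∫ x, F 1 x a ∂ν = 0) (hV : (secondMomentMatrix ν (F 0)).PosDef)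
    (hh : Tendsto h atTop (nhds 0)) {κ : ℝ} (hκ : ∀ᶠ N : ℕ in atTop, √(N : ℝ) * h N ^ 2 = κ)
    {W : ℕ → Ω → Matrix ι ι ℝ} (hWm : ∀ N a b, AEMeasurable (fun ω => W N ω a b) P)
    (hW : ∀ᵐ ω ∂P, ∀ a b, Tendsto (fun N => W N ω a b) atTop
      (nhds (secondMomentMatrix ν (F 0) a b)))
    {m : ℕ → Ω → ι → ℝ} (hm : ∀ N ω, m N ω = (N : ℝ)⁻¹ •
      ∑ i ∈ Finset.range N, ∑ j : Fin 3, h N ^ (j : ℕ) • F j (X i ω)) :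
    TendstoInDistribution (fun (N : ℕ) ω => (N : ℝ) * (m N ω ⬝ᵥ (W N ω)⁻¹ *ᵥ m N ω)) atTop id
      (fun _ => P)
      (noncentralChiSquared
        (κ ^ 2 * ((fun a => ∫ x, F 2 x a ∂ν) ⬝ᵥ
          (secondMomentMatrix ν (F 0))⁻¹ *ᵥ fun a => ∫ x, F 2 x a ∂ν)) (Fintype.card ι)) := by
  classical
  have : IsProbabilityMeasure ν := (hX 0).isProbabilityMeasure_iff.1 inferInstance
  set V := secondMomentMatrix ν (F 0)
  set d : ι → ℝ := fun a => ∫ x, F 2 x a ∂ν with hd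
  -- a joint limit for `F 0` and `F 1` takes care of the product of `h` with the sum of the `F 1`
  let G : S → ι ⊕ ι → ℝ := fun x => Sum.elim (F 0 x) (F 1 x)
  have hG : Measurable G := by
    refine measurable_pi_lambda _ ?_
    rintro (a | a)
    · exact (measurable_pi_apply a).comp (hF 0)
    · exact (measurable_pi_apply a).comp (hF 1)
  have hcltG := tendstoInDistribution_inv_sqrt_smul_sum (F := G) hX hind hG
    (by rintro (a | a); exacts [hL2 0 a, hL2 1 a]) (by rintro (a | a); exacts [h0 a, h1 a])
  have hclt0 := tendstoInDistribution_inv_sqrt_smul_sum (F := F 0) hX hind (hF 0) (hL2 0) h0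
  -- the first block of the joint limit is the limit of the first block
  let π : EuclideanSpace ℝ (ι ⊕ ι) → EuclideanSpace ℝ ι :=
    fun z => WithLp.toLp 2 fun a => z.ofLp (Sum.inl a)
  have hπ : Continuous π := by fun_prop
  have hblock : (multivariateGaussian 0 (secondMomentMatrix ν G)).map π =
      multivariateGaussian 0 V := by
    have h1 := hcltG.continuous_comp hπ
    have h2 : TendstoInDistribution (fun (N : ℕ) => π ∘ fun ω =>
        WithLp.toLp 2 ((√(N : ℝ))⁻¹ • ∑ i ∈ Finset.range N, G (X i ω)))
        atTop id (fun _ => P) (multivariateGaussian 0 V) := by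
      convert hclt0 using 4 with N ω
      ext a
      simp [π, G]
    simpa using tendstoInDistribution_unique _ h1 h2
  let Y : ℕ → Ω → ℝ × (ι → ℝ) × (ι → ι → ℝ) := fun N ω =>
    (h N, fun a => √(N : ℝ) * h N ^ 2 * ((N : ℝ)⁻¹ * ∑ i ∈ Finset.range N, F 2 (X i ω) a),
      fun a b => (W N ω)⁻¹ a b)
  have hYm : ∀ N, AEMeasurable (Y N) P := by
    intro N
    refine aemeasurable_const.prodMk (AEMeasurable.prodMk ?_ ?_)
    · refine aemeasurable_pi_lambda _ fun a => ?_
      have : ∀ i, AEMeasurable (fun ω => F 2 (X i ω) a) P := fun i =>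
        ((measurable_pi_apply a).comp (hF 2)).comp_aemeasurable (hX i).aemeasurable
      exact ((Finset.aemeasurable_fun_sum _ fun i _ => this i).const_mul _).const_mul _
    · exact aemeasurable_pi_lambda _ fun a => aemeasurable_pi_lambda _ fun b =>
        aemeasurable_matrix_inv_apply (hWm N) a b
  have hYlim : TendstoInMeasure P Y atTop fun _ => (0, κ • d, fun a b => V⁻¹ a b) := by
    refine tendstoInMeasure_of_tendsto_ae (fun N => (hYm N).aestronglyMeasurable) ?_
    have hslln : ∀ᵐ ω ∂P, ∀ a, Tendsto
        (fun N : ℕ => (N : ℝ)⁻¹ * ∑ i ∈ Finset.range N, F 2 (X i ω) a) atTop (nhds (d a)) :=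
      ae_all_iff.2 fun a => ae_tendsto_average hX hind ((measurable_pi_apply a).comp (hF 2))
        ((hL2 2 a).integrable (by norm_num))
    filter_upwards [hslln, hW] with ω hω hWω
    refine hh.prodMk_nhds (Tendsto.prodMk_nhds ?_ ?_)
    · exact tendsto_pi_nhds.2 fun a => (tendsto_const_nhds.congr' (hκ.mono fun _ h => h.symm)).mul
        (hω a)
    · exact tendsto_pi_nhds.2 fun a => tendsto_pi_nhds.2 fun b => tendsto_matrix_inv hV hWω a b
  -- the statistic as a continuous function of a convergent vector and of convergent coefficients
  let g : EuclideanSpace ℝ (ι ⊕ ι) × (ℝ × (ι → ℝ) × (ι → ι → ℝ)) → ℝ := fun q =>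
    (fun a => q.1.ofLp (Sum.inl a) + q.2.1 * q.1.ofLp (Sum.inr a) + q.2.2.1 a) ⬝ᵥ
      Matrix.of q.2.2.2 *ᵥ
        fun a => q.1.ofLp (Sum.inl a) + q.2.1 * q.1.ofLp (Sum.inr a) + q.2.2.1 a
  have hg : Continuous g := by
    simp only [g, dotProduct, Matrix.mulVec, Matrix.of_apply]
    fun_prop
  have hmain := hcltG.continuous_comp_prodMk_of_tendstoInMeasure_const hg hYlim hYm
  refine (TendstoInDistribution.of_map_eq (κ := noncentralChiSquared
    (κ ^ 2 * (d ⬝ᵥ V⁻¹ *ᵥ d)) (Fintype.card ι)) hmain ?_).congr (fun N => ae_of_all _ fun ω => ?_)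
    (ae_of_all _ fun _ => rfl)
  · have hlaw := map_quadraticForm_multivariateGaussian hV (κ • d)
    rw [← hblock, Measure.map_map (by simp only [dotProduct, Matrix.mulVec]; fun_prop)
      hπ.measurable] at hlaw
    have hδ : (κ • d) ⬝ᵥ V⁻¹ *ᵥ (κ • d) = κ ^ 2 * (d ⬝ᵥ V⁻¹ *ᵥ d) := by
      rw [Matrix.mulVec_smul, smul_dotProduct, dotProduct_smul, smul_eq_mul, smul_eq_mul]
      ring
    rw [← hδ, ← hlaw]
    congr 1
    ext z
    simp only [g, π, id, zero_mul, add_zero, Function.comp_apply]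
    rfl
  · have hy : (fun a => ((√(N : ℝ))⁻¹ • ∑ i ∈ Finset.range N, G (X i ω)) (Sum.inl a) +
        h N * ((√(N : ℝ))⁻¹ • ∑ i ∈ Finset.range N, G (X i ω)) (Sum.inr a) +
        √(N : ℝ) * h N ^ 2 * ((N : ℝ)⁻¹ * ∑ i ∈ Finset.range N, F 2 (X i ω) a)) =
        √(N : ℝ) • m N ω := by
      ext a
      rw [hm]
      refine Eq.trans ?_ (sqrt_smul_average_eq (fun i j => F j (X i ω)) (h N) N a).symm
      simp [G]
    simp only [g, Y]
    rw [hy]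
    change (√(N : ℝ) • m N ω) ⬝ᵥ (W N ω)⁻¹ *ᵥ (√(N : ℝ) • m N ω) = _
    rw [Matrix.mulVec_smul, smul_dotProduct, dotProduct_smul, smul_eq_mul, smul_eq_mul,
      ← mul_assoc, Real.mul_self_sqrt (Nat.cast_nonneg N)]

/-- Sample second moments of `F 0 + h F 1 + h² F 2` converge to those of `F 0` when `h → 0`. -/
lemma ae_tendsto_sampleSecondMoment (hX : ∀ i, HasLaw (X i) ν P) (hind : iIndepFun X P)
    (hF : ∀ j, Measurable (F j)) (hL2 : ∀ j a, MemLp (fun x => F j x a) 2 ν)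
    (hh : Tendsto h atTop (nhds 0)) :
    ∀ᵐ ω ∂P, ∀ a b, Tendsto (fun N : ℕ => (N : ℝ)⁻¹ * ∑ i ∈ Finset.range N,
        (∑ j : Fin 3, h N ^ (j : ℕ) • F j (X i ω)) a * (∑ j : Fin 3, h N ^ (j : ℕ) • F j (X i ω)) b)
      atTop (nhds (secondMomentMatrix ν (F 0) a b)) := by
  have hm : ∀ j a, Measurable fun x => F j x a := fun j a => (measurable_pi_apply a).comp (hF j)
  have hslln : ∀ᵐ ω ∂P, ∀ a b j k, Tendsto (fun N : ℕ => (N : ℝ)⁻¹ * ∑ i ∈ Finset.range N,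
      F j (X i ω) a * F k (X i ω) b) atTop (nhds (∫ x, F j x a * F k x b ∂ν)) :=
    ae_all_iff.2 fun a => ae_all_iff.2 fun b => ae_all_iff.2 fun j => ae_all_iff.2 fun k =>
      ae_tendsto_average hX hind ((hm j a).mul (hm k b)) ((hL2 j a).integrable_mul (hL2 k b))
  filter_upwards [hslln] with ω hω a b
  have key : ∀ N : ℕ, (N : ℝ)⁻¹ * ∑ i ∈ Finset.range N,
        (∑ j : Fin 3, h N ^ (j : ℕ) • F j (X i ω)) a *
          (∑ j : Fin 3, h N ^ (j : ℕ) • F j (X i ω)) b =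
      ∑ j : Fin 3, ∑ k : Fin 3, h N ^ (j : ℕ) * h N ^ (k : ℕ) *
        ((N : ℝ)⁻¹ * ∑ i ∈ Finset.range N, F j (X i ω) a * F k (X i ω) b) := by
    intro N
    simp only [Fin.sum_univ_three, Pi.smul_apply, Pi.add_apply, smul_eq_mul, Finset.mul_sum,
      ← Finset.sum_add_distrib]
    exact Finset.sum_congr rfl fun i _ => by ring
  simp_rw [key]
  have hlim := tendsto_finsetSum (Finset.univ : Finset (Fin 3)) fun j _ =>
    tendsto_finsetSum (Finset.univ : Finset (Fin 3)) fun k _ =>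
      ((hh.pow (j : ℕ)).mul (hh.pow (k : ℕ))).mul (hω a b j k)
  convert hlim using 2
  simp [Fin.sum_univ_three, secondMomentMatrix]

/-- Sample means of `F 0 + h F 1 + h² F 2` converge to the mean of `F 0` when `h → 0`. -/
lemma ae_tendsto_sampleMean (hX : ∀ i, HasLaw (X i) ν P) (hind : iIndepFun X P)
    (hF : ∀ j, Measurable (F j)) (hint : ∀ j a, Integrable (fun x => F j x a) ν)
    (hh : Tendsto h atTop (nhds 0)) :
    ∀ᵐ ω ∂P, ∀ a, Tendsto (fun N : ℕ => (N : ℝ)⁻¹ * ∑ i ∈ Finset.range N,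
        (∑ j : Fin 3, h N ^ (j : ℕ) • F j (X i ω)) a)
      atTop (nhds (∫ x, F 0 x a ∂ν)) := by
  have hslln : ∀ᵐ ω ∂P, ∀ a j, Tendsto (fun N : ℕ => (N : ℝ)⁻¹ * ∑ i ∈ Finset.range N,
      F j (X i ω) a) atTop (nhds (∫ x, F j x a ∂ν)) :=
    ae_all_iff.2 fun a => ae_all_iff.2 fun j =>
      ae_tendsto_average hX hind ((measurable_pi_apply a).comp (hF j)) (hint j a)
  filter_upwards [hslln] with ω hω a
  have key : ∀ N : ℕ, (N : ℝ)⁻¹ * ∑ i ∈ Finset.range N,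
        (∑ j : Fin 3, h N ^ (j : ℕ) • F j (X i ω)) a =
      ∑ j : Fin 3, h N ^ (j : ℕ) * ((N : ℝ)⁻¹ * ∑ i ∈ Finset.range N, F j (X i ω) a) := by
    intro N
    simp only [Fin.sum_univ_three, Pi.smul_apply, Pi.add_apply, smul_eq_mul, Finset.mul_sum,
      ← Finset.sum_add_distrib]
    exact Finset.sum_congr rfl fun i _ => by ring
  simp_rw [key]
  have hlim := tendsto_finsetSum (Finset.univ : Finset (Fin 3)) fun j _ =>
    (hh.pow (j : ℕ)).mul (hω a j)
  convert hlim using 2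
  simp [Fin.sum_univ_three]

end AndersonRubin

/-! ### Gaussian moments and i.i.d. arrays -/

section GaussianMoments

lemma integral_pow_four_gaussianReal (v : ℝ≥0) :
    ∫ x, x ^ 4 ∂(gaussianReal 0 v) = 3 * (v : ℝ) ^ 2 := by
  have h := iteratedDeriv_mgf_zero (X := id) (μ := gaussianReal 0 v)
    (by simp [integrableExpSet_id_gaussianReal]) 4
  -- the derivative of a polynomial times the moment generating function `exp (v t² / 2)`
  have hd : ∀ q q' r : ℝ → ℝ, (∀ t, HasDerivAt q (q' t) t) → (∀ t, q' t + q t * (v * t) = r t) →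
      deriv (fun t => q t * Real.exp (v * t ^ 2 / 2)) =
        fun t => r t * Real.exp (v * t ^ 2 / 2) := by
    intro q q' r hq hr
    ext t
    have h2 : HasDerivAt (fun t : ℝ => (v : ℝ) * t ^ 2 / 2) (v * t) t :=
      (((hasDerivAt_pow 2 t).const_mul (v : ℝ)).div_const 2).congr_deriv (by norm_num; ring)
    refine ((hq t).mul h2.exp).deriv.trans ?_
    rw [← hr]
    ring
  have e0 : mgf id (gaussianReal 0 v) = fun t => (1 : ℝ) * Real.exp (v * t ^ 2 / 2) := by
    rw [mgf_id_gaussianReal]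
    simp
  have e1 := hd (fun _ => 1) (fun _ => 0) (fun t => v * t) (fun t => hasDerivAt_const _ _)
    fun t => by ring
  have e2 := hd (fun t => v * t) (fun _ => v) (fun t => v + v ^ 2 * t ^ 2)
    (fun t => ((hasDerivAt_id t).const_mul (v : ℝ)).congr_deriv (by ring)) fun t => by ring
  have e3 := hd (fun t => v + v ^ 2 * t ^ 2) (fun t => 2 * v ^ 2 * t)
    (fun t => v ^ 3 * t ^ 3 + 3 * v ^ 2 * t)
    (fun t => (((hasDerivAt_pow 2 t).const_mul ((v : ℝ) ^ 2)).const_add (v : ℝ)).congr_deriv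
      (by norm_num; ring)) fun t => by ring
  have e4 := hd (fun t => v ^ 3 * t ^ 3 + 3 * v ^ 2 * t)
    (fun t => 3 * v ^ 3 * t ^ 2 + 3 * v ^ 2)
    (fun t => v ^ 4 * t ^ 4 + 6 * v ^ 3 * t ^ 2 + 3 * v ^ 2)
    (fun t => (((hasDerivAt_pow 3 t).const_mul ((v : ℝ) ^ 3)).add
      ((hasDerivAt_id t).const_mul (3 * (v : ℝ) ^ 2))).congr_deriv (by norm_num; ring))
    fun t => by ring
  rw [iteratedDeriv_succ, iteratedDeriv_succ, iteratedDeriv_succ, iteratedDeriv_succ,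
    iteratedDeriv_zero, e0, e1, e2, e3, e4] at h
  simpa using h.symm

variable {n : ℕ} {v : ℝ≥0}

/-- The law `N(0, v I)` of a vector with independent centred normal coordinates. -/
noncomputable def gaussianVector (n : ℕ) (v : ℝ≥0) : Measure (Fin n → ℝ) :=
  Measure.pi fun _ => gaussianReal 0 v

instance : IsProbabilityMeasure (gaussianVector n v) := by
  unfold gaussianVector
  infer_instance

lemma measurable_const_dotProduct (c : Fin n → ℝ) : Measurable fun x : Fin n → ℝ => c ⬝ᵥ x :=
  Finset.measurable_sum _ fun j _ => (measurable_pi_apply j).const_mul _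

/-- A linear form `c'x` in a `N(0, v I)` vector is `N(0, v ‖c‖²)`. -/
lemma map_dotProduct_gaussianVector (c : Fin n → ℝ) :
    (gaussianVector n v).map (fun x => c ⬝ᵥ x) = gaussianReal 0 (v * ∑ j, (c j ^ 2).toNNReal) := by
  apply Measure.ext_of_charFun
  ext t
  rw [charFun_apply_real, integral_map (measurable_const_dotProduct c).aemeasurable (by fun_prop),
    charFun_gaussianReal, gaussianVector]
  have h : ∀ x : Fin n → ℝ, Complex.exp (t * ((c ⬝ᵥ x : ℝ) : ℂ) * Complex.I) =
      ∏ j, Complex.exp ((t * c j : ℝ) * x j * Complex.I) := by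
    intro x
    rw [← Complex.exp_sum]
    congr 1
    simp only [dotProduct, Complex.ofReal_sum, Finset.mul_sum, Finset.sum_mul, Complex.ofReal_mul]
    exact Finset.sum_congr rfl fun j _ => by ring
  simp_rw [h]
  rw [integral_fintype_prod_eq_prod
    (f := fun j (y : ℝ) => Complex.exp ((t * c j : ℝ) * y * Complex.I))]
  simp_rw [← charFun_apply_real, charFun_gaussianReal, ← Complex.exp_sum]
  congr 1
  simp only [NNReal.coe_mul, NNReal.coe_sum, Real.coe_toNNReal _ (sq_nonneg _)]
  push_cast
  simp only [mul_zero, zero_mul, zero_sub, Finset.sum_neg_distrib, Finset.mul_sum, Finset.sum_mul,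
    Finset.sum_div]
  congr 1
  exact Finset.sum_congr rfl fun j _ => by ring

lemma memLp_dotProduct_gaussianVector (c : Fin n → ℝ) {p : ENNReal} (hp : p ≠ ⊤) :
    MemLp (fun x => c ⬝ᵥ x) p (gaussianVector n v) := by
  have h := memLp_id_gaussianReal' (μ := 0) (v := v * ∑ j, (c j ^ 2).toNNReal) p hp
  rw [← map_dotProduct_gaussianVector] at h
  exact h.comp_of_map (measurable_const_dotProduct c).aemeasurable

lemma memLp_dotProduct_mul_dotProduct (a b : Fin n → ℝ) :
    MemLp (fun x => (a ⬝ᵥ x) * (b ⬝ᵥ x)) 2 (gaussianVector n v) := by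
  have : ENNReal.HolderTriple 4 4 2 := ⟨by
    rw [show (4 : ENNReal) = 2 * 2 by norm_num, ENNReal.mul_inv (by simp) (by simp), ← two_mul,
      ← mul_assoc, ENNReal.mul_inv_cancel (by simp) (by simp), one_mul]⟩
  have h4 : (4 : ENNReal) ≠ ⊤ := by simp
  exact (memLp_dotProduct_gaussianVector b h4).mul' (memLp_dotProduct_gaussianVector a h4)

lemma integral_dotProduct_sq (c : Fin n → ℝ) :
    ∫ x, (c ⬝ᵥ x) ^ 2 ∂(gaussianVector n v) = v * (c ⬝ᵥ c) := by
  have h := variance_id_gaussianReal (μ := 0) (v := v * ∑ j, (c j ^ 2).toNNReal)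
  rw [variance_of_integral_eq_zero (by fun_prop) (by simp), ← map_dotProduct_gaussianVector,
    integral_map (measurable_const_dotProduct c).aemeasurable (by fun_prop)] at h
  simp only [id] at h
  rw [h]
  simp [dotProduct, pow_two, max_eq_left (mul_self_nonneg _)]

lemma integral_dotProduct_pow_four (c : Fin n → ℝ) :
    ∫ x, (c ⬝ᵥ x) ^ 4 ∂(gaussianVector n v) = 3 * (v * (c ⬝ᵥ c)) ^ 2 := by
  have h := integral_pow_four_gaussianReal (v := v * ∑ j, (c j ^ 2).toNNReal)
  rw [← map_dotProduct_gaussianVector,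
    integral_map (measurable_const_dotProduct c).aemeasurable (by fun_prop)] at h
  rw [h]
  simp [dotProduct, pow_two, max_eq_left (mul_self_nonneg _)]

lemma integral_dotProduct_mul_dotProduct (a b : Fin n → ℝ) :
    ∫ x, (a ⬝ᵥ x) * (b ⬝ᵥ x) ∂(gaussianVector n v) = v * (a ⬝ᵥ b) := by
  have hi : ∀ c : Fin n → ℝ, Integrable (fun x => (c ⬝ᵥ x) ^ 2) (gaussianVector n v) := fun c =>
    (memLp_dotProduct_gaussianVector c (by simp)).integrable_sq
  have h : ∀ x : Fin n → ℝ, (a ⬝ᵥ x) * (b ⬝ᵥ x) =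
      4⁻¹ * (((a + b) ⬝ᵥ x) ^ 2 - ((a - b) ⬝ᵥ x) ^ 2) := by
    intro x
    rw [add_dotProduct, sub_dotProduct]
    ring
  simp_rw [h]
  rw [integral_const_mul, integral_sub (hi _) (hi _), integral_dotProduct_sq,
    integral_dotProduct_sq]
  simp only [add_dotProduct, sub_dotProduct, dotProduct_add, dotProduct_sub, dotProduct_comm b a]
  ring

/-- Isserlis' formula for four linear forms in a Gaussian vector, by polarization of the fourth
moment. -/
theorem integral_dotProduct_mul_four (a b c d : Fin n → ℝ) :
    ∫ x, ((a ⬝ᵥ x) * (b ⬝ᵥ x)) * ((c ⬝ᵥ x) * (d ⬝ᵥ x)) ∂(gaussianVector n v) =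
      (v : ℝ) ^ 2 * ((a ⬝ᵥ b) * (c ⬝ᵥ d) + (a ⬝ᵥ c) * (b ⬝ᵥ d) + (a ⬝ᵥ d) * (b ⬝ᵥ c)) := by
  have hi : ∀ c : Fin n → ℝ, Integrable (fun x => (c ⬝ᵥ x) ^ 4) (gaussianVector n v) := fun c => by
    have := (memLp_dotProduct_mul_dotProduct (v := v) c c).integrable_sq
    refine this.congr (ae_of_all _ fun x => ?_)
    ring
  -- `192 = 8 · 4!`, as the product occurs `4! = 24` times in each of the eight fourth powers
  let s : Fin 8 → ℝ := ![1, -1, -1, 1, -1, 1, 1, -1]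
  let w : Fin 8 → Fin n → ℝ := ![a + b + c + d, a + b + c - d, a + b - c + d, a + b - c - d,
    a - b + c + d, a - b + c - d, a - b - c + d, a - b - c - d]
  have h : ∀ x : Fin n → ℝ, ((a ⬝ᵥ x) * (b ⬝ᵥ x)) * ((c ⬝ᵥ x) * (d ⬝ᵥ x)) =
      192⁻¹ * ∑ k, s k * (w k ⬝ᵥ x) ^ 4 := by
    intro x
    simp [s, w, Fin.sum_univ_succ, add_dotProduct, sub_dotProduct]
    ring
  simp_rw [h]
  rw [integral_const_mul, integral_finsetSum _ fun k _ => (hi _).const_mul _]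
  simp_rw [integral_const_mul, integral_dotProduct_pow_four]
  simp [s, w, Fin.sum_univ_succ, add_dotProduct, sub_dotProduct, dotProduct_add, dotProduct_sub,
    dotProduct_comm b a, dotProduct_comm c a, dotProduct_comm d a, dotProduct_comm c b,
    dotProduct_comm d b, dotProduct_comm d c]
  ring

end GaussianMoments

section QuadraticForms

variable {n : ℕ} {v : ℝ≥0}

lemma dotProduct_mulVec_eq_sum (A : Matrix (Fin n) (Fin n) ℝ) (x : Fin n → ℝ) :
    x ⬝ᵥ A *ᵥ x = ∑ i, ∑ j, A i j * ((Pi.single i 1 ⬝ᵥ x) * (Pi.single j 1 ⬝ᵥ x)) := by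
  simp only [single_one_dotProduct]
  simp only [dotProduct, Matrix.mulVec, Finset.mul_sum]
  exact Finset.sum_congr rfl fun i _ => Finset.sum_congr rfl fun j _ => by ring

lemma memLp_dotProduct_mulVec (A : Matrix (Fin n) (Fin n) ℝ) :
    MemLp (fun x => x ⬝ᵥ A *ᵥ x) 2 (gaussianVector n v) := by
  simp_rw [dotProduct_mulVec_eq_sum]
  exact memLp_finsetSum _ fun i _ => memLp_finsetSum _ fun j _ =>
    (memLp_dotProduct_mul_dotProduct _ _).const_mul _

lemma integral_dotProduct_mulVec (A : Matrix (Fin n) (Fin n) ℝ) :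
    ∫ x, x ⬝ᵥ A *ᵥ x ∂(gaussianVector n v) = v * A.trace := by
  have hi : ∀ i j, Integrable (fun x => A i j * ((Pi.single i 1 ⬝ᵥ x) * (Pi.single j 1 ⬝ᵥ x)))
      (gaussianVector n v) := fun i j =>
    ((memLp_dotProduct_mul_dotProduct _ _).integrable (by norm_num)).const_mul _
  simp_rw [dotProduct_mulVec_eq_sum]
  rw [integral_finsetSum _ fun i _ => integrable_finsetSum _ fun j _ => hi i j]
  simp_rw [integral_finsetSum _ fun j _ => hi _ j, integral_const_mul,
    integral_dotProduct_mul_dotProduct]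
  simp [Pi.single_apply, Matrix.trace, Finset.mul_sum, mul_comm]

/-- For Gaussian `x` and symmetric `B`, the forms `x'Ax` and `x'Bx` have covariance
`2 v² tr (AB)`. -/
lemma integral_dotProduct_mulVec_mul (A : Matrix (Fin n) (Fin n) ℝ) {B : Matrix (Fin n) (Fin n) ℝ}
    (hB : Bᵀ = B) :
    ∫ x, (x ⬝ᵥ A *ᵥ x) * (x ⬝ᵥ B *ᵥ x) ∂(gaussianVector n v) =
      (v : ℝ) ^ 2 * (A.trace * B.trace + 2 * (A * B).trace) := by
  have hi : ∀ i j k l, Integrable (fun x => A i j * B k l * (((Pi.single i 1 ⬝ᵥ x) *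
      (Pi.single j 1 ⬝ᵥ x)) * ((Pi.single k 1 ⬝ᵥ x) * (Pi.single l 1 ⬝ᵥ x))))
      (gaussianVector n v) := fun i j k l =>
    ((memLp_dotProduct_mul_dotProduct _ _).integrable_mul
      (memLp_dotProduct_mul_dotProduct _ _)).const_mul _
  have h : ∀ x : Fin n → ℝ, (x ⬝ᵥ A *ᵥ x) * (x ⬝ᵥ B *ᵥ x) = ∑ i, ∑ j, ∑ k, ∑ l,
      A i j * B k l * (((Pi.single i 1 ⬝ᵥ x) * (Pi.single j 1 ⬝ᵥ x)) *
        ((Pi.single k 1 ⬝ᵥ x) * (Pi.single l 1 ⬝ᵥ x))) := by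
    intro x
    rw [dotProduct_mulVec_eq_sum, dotProduct_mulVec_eq_sum]
    simp only [Finset.sum_mul]
    simp only [Finset.mul_sum]
    refine Finset.sum_congr rfl fun i _ => Finset.sum_congr rfl fun j _ => Finset.sum_congr rfl
      fun k _ => Finset.sum_congr rfl fun l _ => by ring
  simp_rw [h]
  rw [integral_finsetSum _ fun i _ => integrable_finsetSum _ fun j _ => integrable_finsetSum _
    fun k _ => integrable_finsetSum _ fun l _ => hi i j k l]
  simp_rw [integral_finsetSum _ fun j _ => integrable_finsetSum _
    fun k _ => integrable_finsetSum _ fun l _ => hi _ j k l, integral_finsetSum _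
    fun k _ => integrable_finsetSum _ fun l _ => hi _ _ k l, integral_finsetSum _ fun l _ =>
    hi _ _ _ l, integral_const_mul, integral_dotProduct_mul_four]
  have hBs : ∀ i j, B i j = B j i := fun i j => by conv_lhs => rw [← hB, Matrix.transpose_apply]
  simp only [single_one_dotProduct, Pi.single_apply, mul_add, Finset.sum_add_distrib]
  have t1 : ∑ i, ∑ j, ∑ k, ∑ l, A i j * B k l * ((v : ℝ) ^ 2 *
      ((if i = j then (1 : ℝ) else 0) * if k = l then 1 else 0)) =
      (v : ℝ) ^ 2 * (A.trace * B.trace) := by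
    rw [Matrix.trace, Matrix.trace, Finset.sum_mul_sum]
    simp [Finset.mul_sum]
    exact Finset.sum_congr rfl fun i _ => Finset.sum_congr rfl fun j _ => by ring
  have t2 : ∑ i, ∑ j, ∑ k, ∑ l, A i j * B k l * ((v : ℝ) ^ 2 *
      ((if i = k then (1 : ℝ) else 0) * if j = l then 1 else 0)) =
      (v : ℝ) ^ 2 * (A * B).trace := by
    simp [Matrix.trace, Matrix.mul_apply, Finset.mul_sum]
    exact Finset.sum_congr rfl fun i _ => Finset.sum_congr rfl fun j _ => by rw [hBs i j]; ring
  have t3 : ∑ i, ∑ j, ∑ k, ∑ l, A i j * B k l * ((v : ℝ) ^ 2 *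
      ((if i = l then (1 : ℝ) else 0) * if j = k then 1 else 0)) =
      (v : ℝ) ^ 2 * (A * B).trace := by
    simp [Matrix.trace, Matrix.mul_apply, Finset.mul_sum]
    exact Finset.sum_congr rfl fun i _ => Finset.sum_congr rfl fun j _ => by ring
  rw [t1, t2, t3]
  ring

end QuadraticForms

section Panel

variable {Ω : Type*} [MeasurableSpace Ω] {P : Measure Ω} [IsProbabilityMeasure P]

/-- The rows of an i.i.d. array of real variables are i.i.d. vectors, with a product law. -/
lemma hasLaw_pi_and_iIndepFun_rows {κ : Type*} [Fintype κ] {μ : Measure ℝ}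
    [IsProbabilityMeasure μ] {ε : ℕ → κ → Ω → ℝ}
    (hlaw : ∀ i j, HasLaw (ε i j) μ P) (hind : iIndepFun (fun q : ℕ × κ => ε q.1 q.2) P) :
    (∀ i, HasLaw (fun ω j => ε i j ω) (Measure.pi fun _ => μ) P) ∧
      iIndepFun (fun i ω j => ε i j ω) P := by
  have hm : ∀ i, AEMeasurable (fun ω j => ε i j ω) P := fun i =>
    aemeasurable_pi_lambda _ fun j => (hlaw i j).aemeasurable
  have hl : ∀ i, HasLaw (fun ω j => ε i j ω) (Measure.pi fun _ => μ) P := by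
    intro i
    refine ⟨hm i, ?_⟩
    have h1 : iIndepFun (fun j => ε i j) P :=
      hind.precomp (g := fun j : κ => (i, j)) fun j k h => (Prod.mk.inj h).2
    have : ∀ j, IsProbabilityMeasure (P.map (ε i j)) := fun j =>
      Measure.isProbabilityMeasure_map (hlaw i j).aemeasurable
    rw [h1.map_fun_eq_infinitePi_map₀' fun j => (hlaw i j).aemeasurable, Measure.infinitePi_eq_pi]
    simp_rw [(hlaw i _).map_eq]
  refine ⟨hl, (iIndepFun_iff_map_fun_eq_infinitePi_map₀' hm).2 ?_⟩
  have h2 : iIndepFun (fun q : (Σ _ : ℕ, κ) => ε q.1 q.2) P :=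
    hind.precomp (g := fun q : (Σ _ : ℕ, κ) => (q.1, q.2)) (Equiv.sigmaEquivProd ℕ κ).injective
  have h3 := h2.map_fun_eq_infinitePi_map₀' fun q : (Σ _ : ℕ, κ) => (hlaw q.1 q.2).aemeasurable
  simp_rw [(hlaw _ _).map_eq] at h3
  have h4 := Measure.infinitePi_map_piCurry (X := fun (_ : ℕ) (_ : κ) => ℝ) fun _ _ => μ
  rw [← h3, AEMeasurable.map_map_of_aemeasurable (by fun_prop)
    (aemeasurable_pi_lambda _ fun q : (Σ _ : ℕ, κ) => (hlaw q.1 q.2).aemeasurable)] at h4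
  simp_rw [(hl _).map_eq, ← Measure.infinitePi_eq_pi]
  exact h4

end Panel

/-! ### Sums of minima, band matrices and half-vectorization -/

section MinSums

/-- Passing from `n` to `n + 1` adds one row and one column, along which the minimum is the other
index. -/
lemma sum_range_sum_range_min_succ (f : ℕ → ℝ) (n : ℕ) :
    ∑ k ∈ Finset.range (n + 1), ∑ l ∈ Finset.range (n + 1), f (min k l) =
      (∑ k ∈ Finset.range n, ∑ l ∈ Finset.range n, f (min k l)) +
        2 * (∑ k ∈ Finset.range n, f k) + f n := by
  have h : ∀ k ∈ Finset.range n, f (min k n) = f k ∧ f (min n k) = f k := fun k hk => by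
    have := (Finset.mem_range.1 hk).le
    simp [this]
  simp only [Finset.sum_range_succ, Finset.sum_add_distrib, min_self]
  rw [Finset.sum_congr rfl fun k hk => (h k hk).1, Finset.sum_congr rfl fun k hk => (h k hk).2]
  ring

lemma sum_range_succ_cast (n : ℕ) :
    ∑ k ∈ Finset.range n, ((k : ℝ) + 1) = n * (n + 1) / 2 := by
  induction n with
  | zero => simp
  | succ n ih => rw [Finset.sum_range_succ, ih]; push_cast; ring

lemma sum_range_succ_cast_sq (n : ℕ) :
    ∑ k ∈ Finset.range n, ((k : ℝ) + 1) ^ 2 = (n : ℝ) * (n + 1) * (2 * n + 1) / 6 := by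
  induction n with
  | zero => simp
  | succ n ih => rw [Finset.sum_range_succ, ih]; push_cast; ring

lemma sum_range_sum_range_min (n : ℕ) :
    ∑ k ∈ Finset.range n, ∑ l ∈ Finset.range n, (((min k l : ℕ) : ℝ) + 1) =
      (n : ℝ) * (n + 1) * (2 * n + 1) / 6 := by
  induction n with
  | zero => simp
  | succ n ih =>
    rw [sum_range_sum_range_min_succ (fun m => (m : ℝ) + 1), ih, sum_range_succ_cast]
    push_cast
    ring

lemma sum_range_sum_range_min_sq (n : ℕ) :
    ∑ k ∈ Finset.range n, ∑ l ∈ Finset.range n, (((min k l : ℕ) : ℝ) + 1) ^ 2 =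
      (n : ℝ) * (n + 1) * ((n : ℝ) ^ 2 + n + 1) / 6 := by
  induction n with
  | zero => simp
  | succ n ih =>
    rw [sum_range_sum_range_min_succ (fun m => ((m : ℝ) + 1) ^ 2), ih, sum_range_succ_cast_sq]
    push_cast
    ring

end MinSums

section BandMatrices

variable {n : ℕ}

/-- The matrix with ones on the first subdiagonal, so that `D_r = 1 - r L`. -/
def shiftMatrix (n : ℕ) : Matrix (Fin n) (Fin n) ℝ :=
  Matrix.of fun k l => if k.val = l.val + 1 then 1 else 0

/-- The lower triangular matrix of ones, which is the inverse of `D_1`. -/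
def cumulationMatrix (n : ℕ) : Matrix (Fin n) (Fin n) ℝ :=
  Matrix.of fun k l => if l ≤ k then 1 else 0

lemma bandMatrix_eq (r : ℝ) : bandMatrix n r = 1 - r • shiftMatrix n := by
  ext k l
  simp only [bandMatrix, shiftMatrix, Matrix.of_apply, Matrix.sub_apply, Matrix.smul_apply,
    Matrix.one_apply, smul_eq_mul]
  by_cases h : k = l
  · subst h; simp
  · simp only [h, if_false, mul_ite, mul_one, mul_zero]
    split_ifs <;> simp

lemma bandMatrix_eq_add_smul (r : ℝ) :
    bandMatrix n r = bandMatrix n 1 + (1 - r) • shiftMatrix n := by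
  rw [bandMatrix_eq, bandMatrix_eq, sub_smul]
  abel

lemma shiftMatrix_mul_apply (A : Matrix (Fin n) (Fin n) ℝ) (k l : Fin n) :
    (shiftMatrix n * A) k l = if h : 0 < k.val then A ⟨k.val - 1, by omega⟩ l else 0 := by
  simp only [Matrix.mul_apply, shiftMatrix, Matrix.of_apply, ite_mul, one_mul, zero_mul]
  split_ifs with h
  · rw [Finset.sum_eq_single ⟨k.val - 1, by omega⟩]
    · rw [if_pos]
      simp only
      omega
    · intro j _ hj
      rw [if_neg]
      intro hk
      exact hj (Fin.ext (by simp only; omega))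
    · simp
  · exact Finset.sum_eq_zero fun j _ => by rw [if_neg]; omega

lemma shiftMatrix_mul_transpose_apply (k l : Fin n) :
    (shiftMatrix n * (shiftMatrix n)ᵀ) k l = if k = l ∧ 0 < k.val then 1 else 0 := by
  rw [shiftMatrix_mul_apply]
  simp only [shiftMatrix, Matrix.transpose_apply, Matrix.of_apply, Fin.ext_iff]
  split_ifs <;> first | rfl | omega

lemma bandMatrix_one_mul_cumulationMatrix : bandMatrix n 1 * cumulationMatrix n = 1 := by
  rw [bandMatrix_eq, one_smul, sub_mul, one_mul]
  ext k l
  rw [Matrix.sub_apply, shiftMatrix_mul_apply]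
  simp only [cumulationMatrix, Matrix.of_apply, Matrix.one_apply, Fin.ext_iff, Fin.le_def]
  split_ifs <;> first | omega | norm_num

lemma cumulationMatrix_mul_bandMatrix_one : cumulationMatrix n * bandMatrix n 1 = 1 :=
  mul_eq_one_comm.1 bandMatrix_one_mul_cumulationMatrix

lemma bandMatrix_one_mul_transpose :
    bandMatrix n 1 * (bandMatrix n 1)ᵀ =
      1 - shiftMatrix n - (shiftMatrix n)ᵀ + shiftMatrix n * (shiftMatrix n)ᵀ := by
  rw [bandMatrix_eq, one_smul, Matrix.transpose_sub, Matrix.transpose_one]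
  noncomm_ring

lemma cumulationMatrix_mul_transpose_apply (k l : Fin n) :
    (cumulationMatrix n * (cumulationMatrix n)ᵀ) k l = ((min k.val l.val : ℕ) : ℝ) + 1 := by
  simp only [Matrix.mul_apply, cumulationMatrix, Matrix.transpose_apply, Matrix.of_apply,
    ← ite_and, mul_ite, mul_one, mul_zero]
  rw [Finset.sum_boole]
  have : (Finset.univ.filter fun j : Fin n => j ≤ l ∧ j ≤ k) = Finset.Iic (min k l) := by
    ext j
    simp [and_comm]
  rw [this, Fin.card_Iic]
  simp only [Nat.cast_add, Nat.cast_one, add_left_inj, Nat.cast_inj]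
  rcases le_total k l with h | h
  · rw [min_eq_left h, min_eq_left (Fin.le_def.1 h)]
  · rw [min_eq_right h, min_eq_right (Fin.le_def.1 h)]

/-- `D₁` maps the vector of ones to the first unit vector. -/
lemma bandMatrix_one_mulVec_one (k : Fin n) :
    (bandMatrix n 1 *ᵥ fun _ => (1 : ℝ)) k = if k.val = 0 then 1 else 0 := by
  have h := shiftMatrix_mul_apply (Matrix.of fun _ _ : Fin n => (1 : ℝ)) k k
  rw [bandMatrix_eq, one_smul, Matrix.sub_mulVec, Matrix.one_mulVec, Pi.sub_apply]
  have h2 : (shiftMatrix n *ᵥ fun _ => (1 : ℝ)) k = if 0 < k.val then 1 else 0 := by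
    simpa [Matrix.mul_apply, Matrix.mulVec, dotProduct] using h
  rw [h2]
  split_ifs <;> first | omega | norm_num

end BandMatrices

section Vech

variable {n : ℕ}

/-- In the sum of the entries of a symmetric matrix, entries of `vech` off the diagonal count
twice. -/
lemma sum_sum_eq_sum_vechIdx (f : Fin n → Fin n → ℝ) (hf : ∀ k l, f k l = f l k) :
    ∑ k, ∑ l, f k l =
      ∑ q : VechIdx n, (if q.1.1 = q.1.2 then 1 else 2) * f q.1.1 q.1.2 := by
  have h1 : ∑ k, ∑ l, f k l = (∑ k, ∑ l, if l ≤ k then f k l else 0) +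
      ∑ k, ∑ l, if l < k then f k l else 0 := by
    rw [Finset.sum_comm (f := fun k l => if l < k then f k l else 0), ← Finset.sum_add_distrib]
    refine Finset.sum_congr rfl fun k _ => ?_
    rw [← Finset.sum_add_distrib]
    refine Finset.sum_congr rfl fun l _ => ?_
    rcases le_or_gt l k with h | h
    · simp [h, not_lt.2 h]
    · simp [h, not_le.2 h, hf k l]
  have h2 : ∑ q : VechIdx n, (if q.1.1 = q.1.2 then 1 else 2) * f q.1.1 q.1.2 =
      ∑ q : Fin n × Fin n with q.2 ≤ q.1, (if q.1 = q.2 then 1 else 2) * f q.1 q.2 :=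
    (Finset.sum_subtype _ (by simp) fun q : Fin n × Fin n =>
      (if q.1 = q.2 then (1 : ℝ) else 2) * f q.1 q.2).symm
  rw [h1, h2, Finset.sum_filter, Fintype.sum_prod_type, ← Finset.sum_add_distrib]
  refine Finset.sum_congr rfl fun k _ => ?_
  rw [← Finset.sum_add_distrib]
  refine Finset.sum_congr rfl fun l _ => ?_
  rcases lt_trichotomy l k with h | h | h
  · simp [h, h.le, h.ne', two_mul]
  · simp [h]
  · simp [not_le.2 h, not_lt.2 h.le]

/-- The position `(1, 0)` of `vech`. -/
def vechIdxOneZero (hn : 2 ≤ n) : VechIdx n :=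
  ⟨(⟨1, by omega⟩, ⟨0, by omega⟩), by simp [Fin.le_def]⟩

/-- The position `(0, 0)` of `vech`. -/
def vechIdxZeroZero (hn : 2 ≤ n) : VechIdx n :=
  ⟨(⟨0, by omega⟩, ⟨0, by omega⟩), le_rfl⟩

lemma mem_erase_erase_vechIdx_iff (hn : 2 ≤ n) (q : VechIdx n) :
    q ∈ (Finset.univ.erase (vechIdxZeroZero hn)).erase (vechIdxOneZero hn) ↔
      ¬ (q.1.1.val = 0 ∧ q.1.2.val = 0) ∧ ¬ (q.1.1.val = 1 ∧ q.1.2.val = 0) := by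
  simp [vechIdxZeroZero, vechIdxOneZero, Subtype.ext_iff, Prod.ext_iff, Fin.ext_iff]
  tauto

lemma vechIdxOneZero_ne (hn : 2 ≤ n) : vechIdxOneZero hn ≠ vechIdxZeroZero hn := by
  simp [vechIdxZeroZero, vechIdxOneZero]

lemma sum_vechIdx (hn : 2 ≤ n) (f : VechIdx n → ℝ) :
    ∑ q, f q = f (vechIdxZeroZero hn) + f (vechIdxOneZero hn) + ∑ a : MomentIdx n, f a.1 := by
  rw [← Finset.sum_subtype _ (mem_erase_erase_vechIdx_iff hn) f, add_assoc, Finset.add_sum_erase,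
    Finset.add_sum_erase]
  · simp
  · simp [vechIdxOneZero_ne hn]

lemma card_momentIdx (hn : 2 ≤ n) :
    Fintype.card (MomentIdx n) = (n + 1) * n / 2 - 2 := by
  have h1 : Fintype.card (VechIdx n) = (n + 1) * n / 2 := by
    have : (Fintype.card (VechIdx n) : ℝ) = ∑ k ∈ Finset.range n, ((k : ℝ) + 1) := by
      rw [← Finset.card_univ, Finset.cast_card,
        ← Finset.sum_subtype (Finset.univ.filter fun q : Fin n × Fin n => q.2 ≤ q.1)
          (p := fun q => q.2 ≤ q.1) (by simp) (fun _ => (1 : ℝ)),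
        Finset.sum_filter, Fintype.sum_prod_type,
        ← Fin.sum_univ_eq_sum_range (fun k => (k : ℝ) + 1)]
      refine Finset.sum_congr rfl fun k _ => ?_
      rw [Finset.sum_boole]
      have : (Finset.univ.filter fun l : Fin n => l ≤ k) = Finset.Iic k := by ext; simp
      rw [this, Fin.card_Iic]
      push_cast
      rfl
    rw [sum_range_succ_cast] at this
    have h2 : 2 * Fintype.card (VechIdx n) = (n + 1) * n := by
      have : (2 * Fintype.card (VechIdx n) : ℝ) = (n + 1) * n := by rw [this]; ring
      exact_mod_cast this
    omega
  rw [Fintype.card_of_subtype _ (mem_erase_erase_vechIdx_iff hn), Finset.card_erase_of_mem,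
    Finset.card_erase_of_mem, Finset.card_univ, h1]
  · omega
  · simp
  · simp [vechIdxOneZero_ne hn]

end Vech

/-! ### The moment vector as quadratic forms -/

section MomentMatrices

variable {n : ℕ}

/-- The symmetric matrix `A` with `⟨A, Y⟩ = Y k l` for all symmetric `Y`. -/
noncomputable def symUnit (k l : Fin n) : Matrix (Fin n) (Fin n) ℝ :=
  (1 / 2 : ℝ) • (Matrix.single k l 1 + Matrix.single l k 1)

lemma symUnit_transpose (k l : Fin n) : (symUnit k l)ᵀ = symUnit k l := by
  simp [symUnit, Matrix.transpose_add, Matrix.transpose_single, add_comm]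

lemma trace_symUnit_mul (k l : Fin n) (Y : Matrix (Fin n) (Fin n) ℝ) :
    (symUnit k l * Y).trace = (Y k l + Y l k) / 2 := by
  simp [symUnit, Matrix.trace_add, add_mul, Matrix.trace_single_mul]
  ring

/-- The entry of the vector `g`, with `(1, -1, g')' = vech (D₁ D₁')`, at a given position. -/
def momentWeight (a : MomentIdx n) : ℝ := vech (bandMatrix n 1 * (bandMatrix n 1)ᵀ) a.1

/-- The symmetric matrix `Φ` for which `⟨Φ, Y⟩` is a given entry of `P vech Y`, for all symmetric
matrices `Y`. -/
noncomputable def momentMatrix (hn : 2 ≤ n) (a : MomentIdx n) : Matrix (Fin n) (Fin n) ℝ :=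
  symUnit a.1.1.1 a.1.1.2 +
    momentWeight a • symUnit (vechIdxOneZero hn).1.1 (vechIdxOneZero hn).1.2

lemma momentMatrix_transpose (hn : 2 ≤ n) (a : MomentIdx n) :
    (momentMatrix hn a)ᵀ = momentMatrix hn a := by
  simp [momentMatrix, Matrix.transpose_add, symUnit_transpose]

lemma trace_momentMatrix_mul (hn : 2 ≤ n) (a : MomentIdx n) (Y : Matrix (Fin n) (Fin n) ℝ)
    (hY : Yᵀ = Y) :
    (momentMatrix hn a * Y).trace =
      vech Y a.1 + momentWeight a * vech Y (vechIdxOneZero hn) := by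
  have h : ∀ i j, Y j i = Y i j := fun i j => by conv_lhs => rw [← hY, Matrix.transpose_apply]
  simp only [momentMatrix, add_mul, Matrix.trace_add, Matrix.smul_mul, Matrix.trace_smul,
    trace_symUnit_mul, vech, smul_eq_mul]
  rw [h a.1.1.1, h (vechIdxOneZero hn).1.1]
  ring

lemma selectionMatrix_mulVec_vech (hn : 2 ≤ n) (a : MomentIdx n) (Y : Matrix (Fin n) (Fin n) ℝ)
    (hY : Yᵀ = Y) :
    (selectionMatrix n *ᵥ vech Y) a = (momentMatrix hn a * Y).trace := by
  rw [trace_momentMatrix_mul hn a Y hY]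
  have ha := a.2
  have h : ∀ q : VechIdx n, selectionMatrix n a q = (if q = a.1 then 1 else 0) +
      if q = vechIdxOneZero hn then momentWeight a else 0 := by
    intro q
    simp only [selectionMatrix, Matrix.of_apply, momentWeight]
    have h10 : q = vechIdxOneZero hn ↔ q.1.1.val = 1 ∧ q.1.2.val = 0 := by
      simp [vechIdxOneZero, Subtype.ext_iff, Prod.ext_iff, Fin.ext_iff]
    by_cases h1 : q.1.1.val = 0 ∧ q.1.2.val = 0
    · have h2 : q ≠ a.1 := fun h => ha.1 (h ▸ h1)
      have h3 : ¬ q = vechIdxOneZero hn := fun h => by have := (h10.1 h).1; omega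
      simp [h1, h2, h3]
    · by_cases h2 : q.1.1.val = 1 ∧ q.1.2.val = 0
      · have h3 : q ≠ a.1 := fun h => ha.2 (h ▸ h2)
        rw [if_neg h1, if_pos h2, if_neg h3, if_pos (h10.2 h2), zero_add]
      · rw [if_neg h1, if_neg h2, if_neg (mt h10.1 h2), add_zero]
  simp only [Matrix.mulVec, dotProduct, h, add_mul, ite_mul, one_mul, zero_mul,
    Finset.sum_add_distrib, Finset.sum_ite_eq', Finset.mem_univ, if_true]

lemma momentMatrix_trace (hn : 2 ≤ n) (a : MomentIdx n) :
    (momentMatrix hn a).trace = if a.1.1.1 = a.1.1.2 then 1 else 0 := by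
  have h := trace_momentMatrix_mul hn a 1 Matrix.transpose_one
  rw [mul_one] at h
  rw [h]
  simp [vech, vechIdxOneZero, Matrix.one_apply]

lemma shiftMatrix_mul_transpose_oneZero (hn : 2 ≤ n) :
    vech (shiftMatrix n * (shiftMatrix n)ᵀ) (vechIdxOneZero hn) = 0 := by
  simp [vech, shiftMatrix_mul_transpose_apply, vechIdxOneZero]

lemma trace_momentMatrix_mul_shift (hn : 2 ≤ n) (a : MomentIdx n) :
    (momentMatrix hn a * (shiftMatrix n * (shiftMatrix n)ᵀ)).trace =
      if a.1.1.1 = a.1.1.2 then 1 else 0 := by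
  rw [trace_momentMatrix_mul hn a _ (by simp), shiftMatrix_mul_transpose_oneZero, mul_zero,
    add_zero, vech, shiftMatrix_mul_transpose_apply]
  have ha := a.2.1
  refine if_congr ⟨fun h => h.1, fun h => ⟨h, ?_⟩⟩ rfl rfl
  rw [Fin.ext_iff] at h
  omega

lemma momentWeight_eq (a : MomentIdx n) :
    momentWeight a = (if a.1.1.1 = a.1.1.2 then 2 else 0) -
      vech (shiftMatrix n + (shiftMatrix n)ᵀ) a.1 := by
  have ha := a.2.1
  rw [momentWeight, bandMatrix_one_mul_transpose]
  simp only [vech, Matrix.add_apply, Matrix.sub_apply, shiftMatrix_mul_transpose_apply,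
    Matrix.one_apply]
  by_cases h : a.1.1.1 = a.1.1.2
  · have : 0 < a.1.1.1.val := by rw [Fin.ext_iff] at h; omega
    simp [h, h ▸ this]
    ring
  · simp [h]
    ring

lemma vech_shift_oneZero (hn : 2 ≤ n) :
    vech (shiftMatrix n + (shiftMatrix n)ᵀ) (vechIdxOneZero hn) = 1 := by
  simp [vech, vechIdxOneZero, shiftMatrix]

lemma vech_one_oneZero (hn : 2 ≤ n) :
    vech (1 : Matrix (Fin n) (Fin n) ℝ) (vechIdxOneZero hn) = 0 := by
  simp [vech, vechIdxOneZero, Matrix.one_apply]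

lemma trace_momentMatrix_mul_shift_add (hn : 2 ≤ n) (a : MomentIdx n) :
    (momentMatrix hn a * (shiftMatrix n + (shiftMatrix n)ᵀ)).trace =
      if a.1.1.1 = a.1.1.2 then 2 else 0 := by
  rw [trace_momentMatrix_mul hn a _ (by simp [Matrix.transpose_add, add_comm]), vech_shift_oneZero,
    momentWeight_eq]
  ring

/-- The moments at `r = 1` are centred: this is how the vector `g` is chosen. -/
lemma trace_momentMatrix_mul_band (hn : 2 ≤ n) (a : MomentIdx n) :
    (momentMatrix hn a * (bandMatrix n 1 * (bandMatrix n 1)ᵀ)).trace = 0 := by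
  have : bandMatrix n 1 * (bandMatrix n 1)ᵀ =
      1 - (shiftMatrix n + (shiftMatrix n)ᵀ) + shiftMatrix n * (shiftMatrix n)ᵀ := by
    rw [bandMatrix_one_mul_transpose]
    abel
  rw [this, mul_add, mul_sub, Matrix.trace_add, Matrix.trace_sub, mul_one, momentMatrix_trace,
    trace_momentMatrix_mul_shift_add, trace_momentMatrix_mul_shift]
  split_ifs <;> norm_num

/-- The coefficients of `1, h, h²` in the matrix `D_r' Φ D_r` of the quadratic form that is a given
entry of the moment vector, where `h = 1 - r`. -/
noncomputable def driftMatrix (hn : 2 ≤ n) : Fin 3 → MomentIdx n → Matrix (Fin n) (Fin n) ℝ :=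
  ![fun a => (bandMatrix n 1)ᵀ * momentMatrix hn a * bandMatrix n 1,
    fun a => (shiftMatrix n)ᵀ * momentMatrix hn a * bandMatrix n 1 +
      (bandMatrix n 1)ᵀ * momentMatrix hn a * shiftMatrix n,
    fun a => (shiftMatrix n)ᵀ * momentMatrix hn a * shiftMatrix n]

lemma driftMatrix_sum (hn : 2 ≤ n) (a : MomentIdx n) (r : ℝ) :
    ∑ j : Fin 3, (1 - r) ^ (j : ℕ) • driftMatrix hn j a =
      (bandMatrix n r)ᵀ * momentMatrix hn a * bandMatrix n r := by
  rw [bandMatrix_eq_add_smul r]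
  simp only [driftMatrix, Fin.sum_univ_three, Matrix.cons_val_zero, Matrix.cons_val_one,
    Matrix.cons_val, Fin.val_zero, Fin.val_one, Fin.val_two, pow_zero, pow_one, one_smul,
    Matrix.transpose_add, Matrix.transpose_smul, add_mul, mul_add, Matrix.smul_mul,
    Matrix.mul_smul, smul_add, smul_smul, pow_two]
  abel

lemma trace_driftMatrix_zero (hn : 2 ≤ n) (a : MomentIdx n) : (driftMatrix hn 0 a).trace = 0 := by
  simp only [driftMatrix, Matrix.cons_val_zero]
  rw [mul_assoc, Matrix.trace_mul_comm, mul_assoc, trace_momentMatrix_mul_band]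

lemma trace_driftMatrix_one (hn : 2 ≤ n) (a : MomentIdx n) : (driftMatrix hn 1 a).trace = 0 := by
  simp only [driftMatrix, Matrix.cons_val_one, Matrix.cons_val_zero]
  rw [Matrix.trace_add, mul_assoc, Matrix.trace_mul_comm, mul_assoc, mul_assoc (bandMatrix n 1)ᵀ,
    Matrix.trace_mul_comm (bandMatrix n 1)ᵀ, mul_assoc, ← Matrix.trace_add, ← mul_add]
  have : bandMatrix n 1 * (shiftMatrix n)ᵀ + shiftMatrix n * (bandMatrix n 1)ᵀ =
      (shiftMatrix n + (shiftMatrix n)ᵀ) - (2 : ℝ) • (shiftMatrix n * (shiftMatrix n)ᵀ) := by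
    rw [bandMatrix_eq, one_smul, Matrix.transpose_sub, Matrix.transpose_one, two_smul]
    noncomm_ring
  rw [this, mul_sub, Matrix.trace_sub, trace_momentMatrix_mul_shift_add, Matrix.mul_smul,
    Matrix.trace_smul, trace_momentMatrix_mul_shift]
  split_ifs <;> simp

lemma trace_driftMatrix_two (hn : 2 ≤ n) (a : MomentIdx n) :
    (driftMatrix hn 2 a).trace = if a.1.1.1 = a.1.1.2 then 1 else 0 := by
  simp only [driftMatrix, Matrix.cons_val]
  rw [mul_assoc, Matrix.trace_mul_comm, mul_assoc, trace_momentMatrix_mul_shift]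

lemma selectionMatrix_mulVec_vech_eq (hn : 2 ≤ n) (a : MomentIdx n) (r : ℝ) (x : Fin n → ℝ) :
    (selectionMatrix n *ᵥ vech (bandMatrix n r * Matrix.vecMulVec x x * (bandMatrix n r)ᵀ)) a =
      (∑ j : Fin 3, (1 - r) ^ (j : ℕ) • fun a => x ⬝ᵥ driftMatrix hn j a *ᵥ x) a := by
  have hsym : (bandMatrix n r * Matrix.vecMulVec x x * (bandMatrix n r)ᵀ)ᵀ =
      bandMatrix n r * Matrix.vecMulVec x x * (bandMatrix n r)ᵀ := by
    simp [Matrix.transpose_mul, mul_assoc, Matrix.transpose_vecMulVec]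
  rw [selectionMatrix_mulVec_vech hn a _ hsym, ← mul_assoc, Matrix.trace_mul_comm, ← mul_assoc,
    ← mul_assoc, ← driftMatrix_sum, Matrix.mul_vecMulVec, Matrix.trace_vecMulVec,
    Matrix.sum_mulVec, sum_dotProduct]
  simp [Matrix.smul_mulVec, dotProduct_comm]

end MomentMatrices

section Inverse

variable {n : ℕ}

/-- The map `t ↦ ∑ a, t a Φ a` is injective. -/
lemma sum_smul_momentMatrix_eq_zero (hn : 2 ≤ n) {t : MomentIdx n → ℝ}
    (h : ∑ a, t a • momentMatrix hn a = 0) : t = 0 := by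
  ext a
  have hs : (symUnit a.1.1.1 a.1.1.2)ᵀ = symUnit a.1.1.1 a.1.1.2 := symUnit_transpose _ _
  have h1 : ((∑ b, t b • momentMatrix hn b) * symUnit a.1.1.1 a.1.1.2).trace =
      t a * vech (symUnit a.1.1.1 a.1.1.2) a.1 := by
    have hz : ∀ q : VechIdx n, q ≠ a.1 → vech (symUnit a.1.1.1 a.1.1.2) q = 0 := by
      intro q hq
      have h1 : ¬ (a.1.1.1 = q.1.1 ∧ a.1.1.2 = q.1.2) := fun h =>
        hq (Subtype.ext (Prod.ext h.1.symm h.2.symm))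
      have h2 : ¬ (a.1.1.2 = q.1.1 ∧ a.1.1.1 = q.1.2) := fun h => by
        have e1 := a.1.2
        have e2 := q.2
        rw [← h.1, ← h.2] at e2
        have e3 := le_antisymm e1 e2
        exact h1 ⟨by rw [← e3]; exact h.1, by rw [e3]; exact h.2⟩
      simp [vech, symUnit, h1, h2]
    have h10 : vech (symUnit a.1.1.1 a.1.1.2) (vechIdxOneZero hn) = 0 :=
      hz _ fun h => a.2.2 (by rw [← h]; simp [vechIdxOneZero])
    simp only [Finset.sum_mul, Matrix.trace_sum, Matrix.smul_mul, Matrix.trace_smul,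
      trace_momentMatrix_mul hn _ _ hs, h10, mul_zero, add_zero, smul_eq_mul]
    refine Finset.sum_eq_single a (fun b _ hb => ?_) (by simp)
    rw [hz b.1 fun h => hb (Subtype.ext h), mul_zero]
  rw [h, zero_mul, Matrix.trace_zero] at h1
  have h2 : vech (symUnit a.1.1.1 a.1.1.2) a.1 ≠ 0 := by
    have : 0 < vech (symUnit a.1.1.1 a.1.1.2) a.1 := by
      simp only [vech, symUnit, Matrix.smul_apply, Matrix.add_apply, Matrix.single_apply,
        and_self, if_true, smul_eq_mul]
      split_ifs <;> norm_num
    exact this.ne'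
  simpa [h2] using h1.symm

/-- The symmetric matrices orthogonal to `D₁ D₁'` whose first entry vanishes are combinations of
the moment matrices. -/
lemma exists_sum_trace_eq (hn : 2 ≤ n) {W : Matrix (Fin n) (Fin n) ℝ} (hW : Wᵀ = W)
    (h00 : W ⟨0, by omega⟩ ⟨0, by omega⟩ = 0)
    (htr : (W * (bandMatrix n 1 * (bandMatrix n 1)ᵀ)).trace = 0) :
    ∃ w : MomentIdx n → ℝ, ∀ Y : Matrix (Fin n) (Fin n) ℝ, Yᵀ = Y →
      ∑ a, w a * (momentMatrix hn a * Y).trace = (W * Y).trace := by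
  have hpair : ∀ Y : Matrix (Fin n) (Fin n) ℝ, Yᵀ = Y → (W * Y).trace =
      2 * vech W (vechIdxOneZero hn) * vech Y (vechIdxOneZero hn) +
      ∑ a : MomentIdx n, (if a.1.1.1 = a.1.1.2 then 1 else 2) * vech W a.1 * vech Y a.1 := by
    intro Y hY
    have hYs : ∀ i j, Y j i = Y i j := fun i j => by conv_lhs => rw [← hY, Matrix.transpose_apply]
    have hWs : ∀ i j, W j i = W i j := fun i j => by conv_lhs => rw [← hW, Matrix.transpose_apply]
    have h1 : (W * Y).trace = ∑ k, ∑ l, W k l * Y k l := by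
      simp only [Matrix.trace, Matrix.diag, Matrix.mul_apply]
      exact Finset.sum_congr rfl fun k _ => Finset.sum_congr rfl fun l _ => by rw [hYs k l]
    rw [h1, sum_sum_eq_sum_vechIdx (fun k l => W k l * Y k l) fun k l => by rw [hYs k l, hWs k l],
      sum_vechIdx hn]
    have h2 : W (vechIdxZeroZero hn).1.1 (vechIdxZeroZero hn).1.2 = 0 := h00
    rw [h2]
    simp [vech, vechIdxOneZero, mul_assoc]
  refine ⟨fun a => (if a.1.1.1 = a.1.1.2 then 1 else 2) * vech W a.1, fun Y hY => ?_⟩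
  have hD := hpair (bandMatrix n 1 * (bandMatrix n 1)ᵀ) (by simp)
  have h10 : vech (bandMatrix n 1 * (bandMatrix n 1)ᵀ) (vechIdxOneZero hn) = -1 := by
    have h := shiftMatrix_mul_transpose_oneZero hn
    have h' := vech_shift_oneZero hn
    have h'' := vech_one_oneZero hn
    rw [bandMatrix_one_mul_transpose]
    simp only [vech, Matrix.add_apply, Matrix.sub_apply] at h h' h'' ⊢
    linarith
  rw [htr, h10] at hD
  rw [hpair Y hY]
  simp only [trace_momentMatrix_mul hn _ Y hY, mul_add, Finset.sum_add_distrib]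
  have h3 : ∑ a : MomentIdx n, (if a.1.1.1 = a.1.1.2 then (1 : ℝ) else 2) * vech W a.1 *
      (momentWeight a * vech Y (vechIdxOneZero hn)) =
      (∑ a : MomentIdx n, (if a.1.1.1 = a.1.1.2 then (1 : ℝ) else 2) * vech W a.1 *
        vech (bandMatrix n 1 * (bandMatrix n 1)ᵀ) a.1) * vech Y (vechIdxOneZero hn) := by
    rw [Finset.sum_mul]
    exact Finset.sum_congr rfl fun a _ => by rw [momentWeight]; ring
  rw [h3]
  linear_combination (-vech Y (vechIdxOneZero hn)) * hD

end Inverse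

/-! ### The noncentrality parameter -/

section Noncentrality

variable {n : ℕ} {v : ℝ≥0}

/-- The coefficients of the moment vector at drift `h`, as functions of the first differences. -/
noncomputable def driftForm (hn : 2 ≤ n) (j : Fin 3) (x : Fin n → ℝ) (a : MomentIdx n) : ℝ :=
  x ⬝ᵥ driftMatrix hn j a *ᵥ x

lemma measurable_driftForm (hn : 2 ≤ n) (j : Fin 3) : Measurable (driftForm hn j) := by
  refine measurable_pi_lambda _ fun a => ?_
  simp only [driftForm, dotProduct, Matrix.mulVec]
  fun_prop

lemma memLp_driftForm (hn : 2 ≤ n) (j : Fin 3) (a : MomentIdx n) :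
    MemLp (fun x => driftForm hn j x a) 2 (gaussianVector n v) :=
  memLp_dotProduct_mulVec _

lemma dotProduct_driftForm_zero (hn : 2 ≤ n) (t : MomentIdx n → ℝ) (x : Fin n → ℝ) :
    t ⬝ᵥ driftForm hn 0 x = x ⬝ᵥ ((bandMatrix n 1)ᵀ * (∑ a, t a • momentMatrix hn a) *
      bandMatrix n 1) *ᵥ x := by
  have : (bandMatrix n 1)ᵀ * (∑ a, t a • momentMatrix hn a) * bandMatrix n 1 =
      ∑ a, t a • driftMatrix hn 0 a := by
    simp [driftMatrix, Finset.mul_sum, Finset.sum_mul]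
  rw [this, Matrix.sum_mulVec, dotProduct_sum]
  refine Finset.sum_congr rfl fun a _ => ?_
  rw [Matrix.smul_mulVec, dotProduct_smul, smul_eq_mul]
  rfl

/-- The covariance matrix of the moments at `r = 1` is invertible: `t' V t` is `2 v² tr (Q²)` for a
symmetric `Q` that depends on `t` injectively. -/
lemma posDef_secondMomentMatrix_driftForm (hn : 2 ≤ n) (hv : 0 < v) :
    (secondMomentMatrix (gaussianVector n v) (driftForm hn 0)).PosDef := by
  refine Matrix.PosDef.of_dotProduct_mulVec_pos isHermitian_secondMomentMatrix fun t ht => ?_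
  rw [star_trivial, dotProduct_secondMomentMatrix_mulVec (memLp_driftForm hn 0)]
  simp_rw [dotProduct_driftForm_zero]
  set Φ := ∑ a, t a • momentMatrix hn a
  have hΦ : Φᵀ = Φ := by
    simp [Φ, Matrix.transpose_sum, Matrix.transpose_smul, momentMatrix_transpose]
  set Q := (bandMatrix n 1)ᵀ * Φ * bandMatrix n 1
  have hQ : Qᵀ = Q := by simp [Q, Matrix.transpose_mul, hΦ, mul_assoc]
  rw [integral_dotProduct_mulVec_mul _ hQ]
  have hne : Q ≠ 0 := by
    intro h0
    refine ht (sum_smul_momentMatrix_eq_zero hn ?_)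
    have h1 : (cumulationMatrix n)ᵀ * Q * cumulationMatrix n = Φ := by
      simp only [Q, ← mul_assoc]
      rw [← Matrix.transpose_mul, bandMatrix_one_mul_cumulationMatrix, Matrix.transpose_one,
        one_mul, mul_assoc, bandMatrix_one_mul_cumulationMatrix, mul_one]
    change Φ = 0
    rw [← h1, h0, mul_zero, zero_mul]
  have hpos : 0 < (Q * Q).trace := by
    have h := Matrix.posSemidef_conjTranspose_mul_self Q
    rw [Matrix.conjTranspose_eq_transpose_of_trivial, hQ] at h
    refine lt_of_le_of_ne h.trace_nonneg fun h0 => hne ?_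
    have := Matrix.trace_conjTranspose_mul_self_eq_zero_iff (A := Q)
    rw [Matrix.conjTranspose_eq_transpose_of_trivial, hQ] at this
    exact this.1 h0.symm
  have hv' : (0 : ℝ) < v := hv
  have := mul_self_nonneg Q.trace
  positivity

/-- The matrix `M - α I - β J`, with `M = (D₁' D₁)⁻¹` and `J` the matrix of ones: the projection of
`M` on the symmetric matrices of trace zero whose entries sum to zero. -/
noncomputable def projectedMatrix (n : ℕ) : Matrix (Fin n) (Fin n) ℝ :=
  cumulationMatrix n * (cumulationMatrix n)ᵀ - (((n : ℝ) + 1) / 6) • 1 -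
    (((n : ℝ) + 1) / 3) • Matrix.vecMulVec (fun _ => 1) fun _ => 1

lemma trace_cumulationMatrix :
    (cumulationMatrix n * (cumulationMatrix n)ᵀ).trace = n * ((n : ℝ) + 1) / 2 := by
  rw [← sum_range_succ_cast, ← Fin.sum_univ_eq_sum_range (fun k => (k : ℝ) + 1)]
  simp [Matrix.trace, Matrix.diag, cumulationMatrix_mul_transpose_apply]

lemma sum_cumulationMatrix :
    (fun _ => (1 : ℝ)) ⬝ᵥ (cumulationMatrix n * (cumulationMatrix n)ᵀ) *ᵥ (fun _ => 1) =
      n * ((n : ℝ) + 1) * (2 * n + 1) / 6 := by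
  rw [← sum_range_sum_range_min, ← Fin.sum_univ_eq_sum_range
    (fun k => ∑ l ∈ Finset.range n, (((min k l : ℕ) : ℝ) + 1))]
  simp only [dotProduct, Matrix.mulVec, one_mul, mul_one, cumulationMatrix_mul_transpose_apply]
  exact Finset.sum_congr rfl fun k _ =>
    Fin.sum_univ_eq_sum_range (fun l => (((min k.val l : ℕ) : ℝ) + 1)) n

lemma trace_cumulationMatrix_sq :
    (cumulationMatrix n * (cumulationMatrix n)ᵀ *
        (cumulationMatrix n * (cumulationMatrix n)ᵀ)).trace =
      n * ((n : ℝ) + 1) * ((n : ℝ) ^ 2 + n + 1) / 6 := by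
  rw [← sum_range_sum_range_min_sq, ← Fin.sum_univ_eq_sum_range
    (fun k => ∑ l ∈ Finset.range n, (((min k l : ℕ) : ℝ) + 1) ^ 2)]
  simp only [Matrix.trace, Matrix.diag, Matrix.mul_apply (M := cumulationMatrix n * _),
    cumulationMatrix_mul_transpose_apply]
  refine Finset.sum_congr rfl fun k _ => ?_
  rw [← Fin.sum_univ_eq_sum_range (fun l => (((min k.val l : ℕ) : ℝ) + 1) ^ 2)]
  exact Finset.sum_congr rfl fun l _ => by rw [min_comm l.val, pow_two]

lemma projectedMatrix_transpose : (projectedMatrix n)ᵀ = projectedMatrix n := by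
  simp [projectedMatrix, Matrix.transpose_sub, Matrix.transpose_mul, Matrix.transpose_vecMulVec]

lemma trace_projectedMatrix : (projectedMatrix n).trace = 0 := by
  simp only [projectedMatrix, Matrix.trace_sub, trace_cumulationMatrix, Matrix.trace_smul,
    Matrix.trace_one, Matrix.trace_vecMulVec, Fintype.card_fin, smul_eq_mul]
  simp [dotProduct]
  ring

lemma sum_projectedMatrix :
    (fun _ => (1 : ℝ)) ⬝ᵥ projectedMatrix n *ᵥ (fun _ => 1) = 0 := by
  simp only [projectedMatrix, Matrix.sub_mulVec, dotProduct_sub, sum_cumulationMatrix,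
    Matrix.smul_mulVec, Matrix.one_mulVec, dotProduct_smul, Matrix.vecMulVec_mulVec]
  simp [dotProduct]
  ring

lemma trace_projectedMatrix_mul :
    (projectedMatrix n * (cumulationMatrix n * (cumulationMatrix n)ᵀ)).trace =
      n * ((n : ℝ) + 1) * (2 * n - 1) * (n - 1) / 36 := by
  simp only [projectedMatrix, sub_mul, Matrix.trace_sub, trace_cumulationMatrix_sq,
    Matrix.smul_mul, one_mul, Matrix.trace_smul, trace_cumulationMatrix, smul_eq_mul,
    Matrix.vecMulVec_mul, Matrix.trace_vecMulVec]
  rw [dotProduct_comm, ← Matrix.dotProduct_mulVec, sum_cumulationMatrix]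
  ring

/-- Since `D₁ M D₁' = I`, since moments at `r = 1` ignore `D₁ D₁'`, and since `D₁ J D₁'` only has an
entry at `(0, 0)`, which `P` discards, only the direction of the drift is left. -/
lemma trace_driftMatrix_mul_projectedMatrix (hn : 2 ≤ n) (a : MomentIdx n) :
    (driftMatrix hn 0 a * projectedMatrix n).trace = if a.1.1.1 = a.1.1.2 then 1 else 0 := by
  set D := bandMatrix n 1
  have h1 : (driftMatrix hn 0 a * projectedMatrix n).trace =
      (momentMatrix hn a * (D * projectedMatrix n * Dᵀ)).trace := by
    simp only [driftMatrix, Matrix.cons_val_zero]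
    rw [mul_assoc, mul_assoc, Matrix.trace_mul_comm, mul_assoc]
  have h2 : D * (cumulationMatrix n * (cumulationMatrix n)ᵀ) * Dᵀ = 1 := by
    rw [← mul_assoc, bandMatrix_one_mul_cumulationMatrix, one_mul, ← Matrix.transpose_mul,
      bandMatrix_one_mul_cumulationMatrix, Matrix.transpose_one]
  set o : Fin n → ℝ := fun _ => 1
  have h3 : D * Matrix.vecMulVec o o * Dᵀ = Matrix.vecMulVec (D *ᵥ o) (D *ᵥ o) := by
    rw [Matrix.mul_vecMulVec, Matrix.vecMulVec_mul, Matrix.vecMul_transpose]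
  have h4 : (momentMatrix hn a * Matrix.vecMulVec (D *ᵥ o) (D *ᵥ o)).trace = 0 := by
    rw [trace_momentMatrix_mul hn a _ (Matrix.transpose_vecMulVec _ _)]
    have ha := a.2.1
    simp only [vech, Matrix.vecMulVec_apply, D, o, bandMatrix_one_mulVec_one, vechIdxOneZero]
    split_ifs <;> simp_all
  rw [h1, projectedMatrix, mul_sub, mul_sub, sub_mul, sub_mul, h2, Matrix.mul_smul,
    Matrix.mul_smul, Matrix.smul_mul, Matrix.smul_mul, h3, mul_one, mul_sub, mul_sub, mul_one,
    Matrix.mul_smul, Matrix.mul_smul, Matrix.trace_sub, Matrix.trace_sub, Matrix.trace_smul,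
    Matrix.trace_smul, h4, trace_momentMatrix_mul_band, momentMatrix_trace]
  simp

lemma dotProduct_mul_mul_mulVec (D A : Matrix (Fin n) (Fin n) ℝ) (x : Fin n → ℝ) :
    x ⬝ᵥ (Dᵀ * A * D) *ᵥ x = (A * Matrix.vecMulVec (D *ᵥ x) (D *ᵥ x)).trace := by
  rw [Matrix.mul_vecMulVec, Matrix.trace_vecMulVec, dotProduct_comm (A *ᵥ _),
    ← Matrix.vecMul_transpose D, ← Matrix.dotProduct_mulVec, Matrix.vecMul_transpose,
    Matrix.mulVec_mulVec, Matrix.mulVec_mulVec, mul_assoc]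

/-- Let `d` be the indicator of the diagonal positions. The vector `w` of coefficients that
represents `x' R x`, with `R = projectedMatrix n`, as a combination of the moments at `r = 1` solves
`V w = 2 v² d`, which avoids computing `V⁻¹`. -/
lemma exists_mulVec_eq (hn : 2 ≤ n) (v : ℝ≥0) :
    ∃ w : MomentIdx n → ℝ,
      secondMomentMatrix (gaussianVector n v) (driftForm hn 0) *ᵥ w =
        (2 * (v : ℝ) ^ 2) • (fun a => if a.1.1.1 = a.1.1.2 then 1 else 0) ∧
      (fun a : MomentIdx n => if a.1.1.1 = a.1.1.2 then (1 : ℝ) else 0) ⬝ᵥ w =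
        n * ((n : ℝ) + 1) * (2 * n - 1) * (n - 1) / 36 := by
  set E := cumulationMatrix n
  set R := projectedMatrix n
  have hR : Rᵀ = R := projectedMatrix_transpose
  have hDE : bandMatrix n 1 * E = 1 := bandMatrix_one_mul_cumulationMatrix
  have hED : E * bandMatrix n 1 = 1 := cumulationMatrix_mul_bandMatrix_one
  -- the first column of `E` consists of ones, so this entry is the sum of the entries of `R`
  have h00 : (Eᵀ * R * E) ⟨0, by omega⟩ ⟨0, by omega⟩ = 0 := by
    rw [← sum_projectedMatrix (n := n)]
    simp only [Matrix.mul_apply, E, cumulationMatrix, dotProduct, Matrix.mulVec, Fin.le_def,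
      Matrix.transpose_apply, Matrix.of_apply, Nat.zero_le, if_true, one_mul, mul_one]
    exact Finset.sum_comm
  have htr : (Eᵀ * R * E * (bandMatrix n 1 * (bandMatrix n 1)ᵀ)).trace = 0 := by
    rw [← mul_assoc, mul_assoc _ E, hED, mul_one, Matrix.trace_mul_comm, ← mul_assoc,
      ← Matrix.transpose_mul, hED, Matrix.transpose_one, one_mul]
    exact trace_projectedMatrix
  obtain ⟨w, hw⟩ := exists_sum_trace_eq hn (W := Eᵀ * R * E)
    (by simp [Matrix.transpose_mul, hR, mul_assoc]) h00 htr
  have hform : ∀ x, w ⬝ᵥ driftForm hn 0 x = x ⬝ᵥ R *ᵥ x := by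
    intro x
    have h1 := hw (Matrix.vecMulVec (bandMatrix n 1 *ᵥ x) (bandMatrix n 1 *ᵥ x))
      (Matrix.transpose_vecMulVec _ _)
    simp_rw [← dotProduct_mul_mul_mulVec] at h1
    refine h1.trans ?_
    have : (bandMatrix n 1)ᵀ * (Eᵀ * R * E) * bandMatrix n 1 = R := by
      rw [mul_assoc, mul_assoc (Eᵀ * R), hED, mul_one, ← mul_assoc, ← Matrix.transpose_mul, hED,
        Matrix.transpose_one, one_mul]
    rw [this]
  refine ⟨w, ?_, ?_⟩
  · ext a
    rw [← single_one_dotProduct a (_ *ᵥ w), dotProduct_secondMomentMatrix_mulVec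
      (memLp_driftForm hn 0)]
    simp_rw [hform, single_one_dotProduct]
    simp only [driftForm]
    rw [integral_dotProduct_mulVec_mul _ hR, trace_driftMatrix_zero,
      trace_driftMatrix_mul_projectedMatrix]
    simp only [Pi.smul_apply, smul_eq_mul]
    ring
  · have h1 := hw 1 Matrix.transpose_one
    simp only [mul_one, momentMatrix_trace] at h1
    rw [dotProduct_comm]
    refine h1.trans ?_
    rw [mul_assoc, Matrix.trace_mul_comm, mul_assoc, trace_projectedMatrix_mul]

/-- The mean of the coefficient of `h²` is `v` times the indicator of the diagonal positions. -/
lemma integral_driftForm_two (hn : 2 ≤ n) (v : ℝ≥0) :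
    (fun a => ∫ x, driftForm hn 2 x a ∂(gaussianVector n v)) =
      (v : ℝ) • fun a => if a.1.1.1 = a.1.1.2 then (1 : ℝ) else 0 := by
  ext a
  simp only [driftForm, integral_dotProduct_mulVec, trace_driftMatrix_two, Pi.smul_apply,
    smul_eq_mul]

/-- The value of `E[F₂]' V⁻¹ E[F₂]`, which does not depend on `v`. -/
theorem noncentrality_eq (hn : 2 ≤ n) (hv : 0 < v) :
    (fun a => ∫ x, driftForm hn 2 x a ∂(gaussianVector n v)) ⬝ᵥ
      (secondMomentMatrix (gaussianVector n v) (driftForm hn 0))⁻¹ *ᵥ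
        (fun a => ∫ x, driftForm hn 2 x a ∂(gaussianVector n v)) =
      n * ((n : ℝ) + 1) * (2 * n - 1) * (n - 1) / 72 := by
  obtain ⟨w, hw, hd⟩ := exists_mulVec_eq hn v
  set V := secondMomentMatrix (gaussianVector n v) (driftForm hn 0)
  have hV : IsUnit V.det :=
    (Matrix.isUnit_iff_isUnit_det _).1 (posDef_secondMomentMatrix_driftForm hn hv).isUnit
  rw [integral_driftForm_two]
  set d : MomentIdx n → ℝ := fun a => if a.1.1.1 = a.1.1.2 then (1 : ℝ) else 0
  have hv' : (v : ℝ) ≠ 0 := by exact_mod_cast hv.ne'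
  have h1 : d = (2 * (v : ℝ) ^ 2)⁻¹ • V *ᵥ w := by
    rw [hw, smul_smul, inv_mul_cancel₀ (by positivity), one_smul]
  have h2 : V⁻¹ *ᵥ d = (2 * (v : ℝ) ^ 2)⁻¹ • w := by
    rw [h1, Matrix.mulVec_smul, Matrix.mulVec_mulVec, Matrix.nonsing_inv_mul _ hV,
      Matrix.one_mulVec]
  rw [Matrix.mulVec_smul, h2, smul_dotProduct, dotProduct_smul, dotProduct_smul, hd]
  simp only [smul_eq_mul]
  field_simp
  ring

end Noncentrality

/-! ### The panel model under a unit root -/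

section UnitRoot

variable {Ω : Type*} {T : ℕ} {μ : ℕ → Ω → ℝ} {ε y : ℕ → ℕ → Ω → ℝ}

lemma firstDiff_eq (hy : IsPanelAR1 T 1 μ ε y) (i : ℕ) (ω : Ω) (j : Fin (T - 1)) :
    firstDiff T y i ω j = ε i (j.val + 2) ω := by
  have hj := j.isLt
  have h := hy i (j.val + 2) ω (by omega) (by omega)
  rw [show j.val + 2 - 1 = j.val + 1 by omega] at h
  simp only [firstDiff]
  rw [h]
  ring

lemma momentContribution_eq (hn : 2 ≤ T - 1) (r : ℝ) (i : ℕ) (ω : Ω) :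
    momentContribution T y r i ω =
      ∑ j : Fin 3, (1 - r) ^ (j : ℕ) • driftForm hn j (firstDiff T y i ω) := by
  ext a
  exact selectionMatrix_mulVec_vech_eq hn a r _

lemma eickerWhiteCentered_apply (N : ℕ) (r : ℝ) (ω : Ω) (a b : MomentIdx (T - 1)) :
    eickerWhiteCentered T y N r ω a b =
      eickerWhite T y N r ω a b - sampleMoment T y N r ω a * sampleMoment T y N r ω b := by
  rcases N.eq_zero_or_pos with rfl | hN
  · simp [eickerWhiteCentered, eickerWhite, sampleMoment]
  have hN' : (N : ℝ) ≠ 0 := by exact_mod_cast hN.ne'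
  have hs : ∀ c, ∑ i ∈ Finset.range N, momentContribution T y r i ω c =
      N * sampleMoment T y N r ω c := fun c => by
    simp [sampleMoment, hN']
  simp only [eickerWhiteCentered, eickerWhite, Matrix.smul_apply, Matrix.sum_apply,
    Matrix.vecMulVec_apply, Pi.sub_apply, smul_eq_mul, sub_mul, mul_sub, Finset.sum_sub_distrib,
    ← Finset.sum_mul, ← Finset.mul_sum, hs, Finset.sum_const, Finset.card_range, nsmul_eq_mul]
  field_simp
  ring

variable [MeasurableSpace Ω] {P : Measure Ω} [IsProbabilityMeasure P] {v : ℝ≥0}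

/-- Under the unit root, the vectors of first differences are i.i.d. Gaussian. -/
lemma hasLaw_firstDiff_and_iIndepFun (hε : IIDNormalErrors P T v ε) (hy : IsPanelAR1 T 1 μ ε y) :
    (∀ i, HasLaw (firstDiff T y i) (gaussianVector (T - 1) v) P) ∧
      iIndepFun (firstDiff T y) P := by
  have hfd : firstDiff T y = fun i ω j => ε i (j.val + 2) ω := by
    ext i ω j
    exact firstDiff_eq hy i ω j
  have hmem : ∀ j : Fin (T - 1), j.val + 2 ∈ Finset.Icc 2 T := fun j => by
    have := j.isLt
    rw [Finset.mem_Icc]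
    omega
  rw [hfd]
  refine hasLaw_pi_and_iIndepFun_rows (ε := fun i (j : Fin (T - 1)) => ε i (j.val + 2))
    (fun i j => hε.law i _ (hmem j)) ?_
  refine hε.indep.precomp (g := fun q : ℕ × Fin (T - 1) => (q.1, ⟨q.2.val + 2, hmem q.2⟩)) ?_
  rintro ⟨i, j⟩ ⟨i', j'⟩ h
  simp only [Prod.mk.injEq, Subtype.mk.injEq, add_left_inj] at h
  exact Prod.ext h.1 (Fin.ext h.2)

end UnitRoot

lemma tendsto_div_rpow_fourth (e : ℝ) :
    Tendsto (fun N : ℕ => e / (N : ℝ) ^ (1 / 4 : ℝ)) atTop (nhds 0) :=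
  ((tendsto_rpow_atTop (by norm_num)).comp tendsto_natCast_atTop_atTop).const_div_atTop e

lemma sqrt_mul_div_rpow_fourth_sq (e : ℝ) {N : ℕ} (hN : 0 < N) :
    √(N : ℝ) * (e / (N : ℝ) ^ (1 / 4 : ℝ)) ^ 2 = e ^ 2 := by
  have hN' : (0 : ℝ) < N := by exact_mod_cast hN
  have h : ((N : ℝ) ^ (1 / 4 : ℝ)) ^ 2 = √(N : ℝ) := by
    rw [← Real.rpow_natCast, ← Real.rpow_mul hN'.le, Real.sqrt_eq_rpow]
    norm_num
  rw [div_pow, h, mul_div_cancel₀ _ (Real.sqrt_pos.2 hN').ne']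

theorem theorem7 {Ω : Type*} [MeasurableSpace Ω] (P : Measure Ω) [IsProbabilityMeasure P]
    (T : ℕ) (hT : 3 ≤ T) (v : ℝ≥0) (hv : 0 < v)
    (μ : ℕ → Ω → ℝ) (ε y : ℕ → ℕ → Ω → ℝ)
    (hε : IIDNormalErrors P T v ε)
    (hy : IsPanelAR1 T 1 μ ε y) (e : ℝ) :
    TendstoInDistribution
        (fun (N : ℕ) ω => gmmAR T y (eickerWhite T y) N (1 - e / (N : ℝ) ^ (1 / 4 : ℝ)) ω)
        atTop id (fun _ => P)
        (noncentralChiSquared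
          (e ^ 4 * ((2 * (T : ℝ) - 3) * T * ((T : ℝ) - 1) * ((T : ℝ) - 2) / 72))
          (T * (T - 1) / 2 - 2)) ∧
      TendstoInDistribution
        (fun (N : ℕ) ω => gmmAR T y (eickerWhiteCentered T y) N (1 - e / (N : ℝ) ^ (1 / 4 : ℝ)) ω)
        atTop id (fun _ => P)
        (noncentralChiSquared
          (e ^ 4 * ((2 * (T : ℝ) - 3) * T * ((T : ℝ) - 1) * ((T : ℝ) - 2) / 72))
          (T * (T - 1) / 2 - 2)) := by
  have hn : 2 ≤ T - 1 := by omega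
  obtain ⟨hX, hind⟩ := hasLaw_firstDiff_and_iIndepFun hε hy
  set h : ℕ → ℝ := fun N => e / (N : ℝ) ^ (1 / 4 : ℝ) with hh
  have hlim : Tendsto h atTop (nhds 0) := tendsto_div_rpow_fourth e
  have hκ : ∀ᶠ N : ℕ in atTop, √(N : ℝ) * h N ^ 2 = e ^ 2 :=
    (eventually_gt_atTop 0).mono fun N hN => sqrt_mul_div_rpow_fourth_sq e hN
  have hmc : ∀ N i ω, momentContribution T y (1 - h N) i ω =
      ∑ j : Fin 3, h N ^ (j : ℕ) • driftForm hn j (firstDiff T y i ω) := fun N i ω => by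
    rw [momentContribution_eq hn, sub_sub_cancel]
  have hm : ∀ N ω, sampleMoment T y N (1 - h N) ω = (N : ℝ)⁻¹ • ∑ i ∈ Finset.range N,
      ∑ j : Fin 3, h N ^ (j : ℕ) • driftForm hn j (firstDiff T y i ω) := fun N ω => by
    simp only [sampleMoment, hmc]
  have hL2 : ∀ j a, MemLp (fun x => driftForm hn j x a) 2 (gaussianVector (T - 1) v) :=
    memLp_driftForm hn
  have hmeas := measurable_driftForm hn
  have h0 : ∀ a, ∫ x, driftForm hn 0 x a ∂(gaussianVector (T - 1) v) = 0 := fun a => by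
    simp only [driftForm, integral_dotProduct_mulVec, trace_driftMatrix_zero, mul_zero]
  have h1 : ∀ a, ∫ x, driftForm hn 1 x a ∂(gaussianVector (T - 1) v) = 0 := fun a => by
    simp only [driftForm, integral_dotProduct_mulVec, trace_driftMatrix_one, mul_zero]
  -- measurability and consistency of the two covariance estimators
  have hmcm : ∀ N i a, AEMeasurable (fun ω => momentContribution T y (1 - h N) i ω a) P := by
    intro N i a
    simp only [hmc]
    have : Measurable fun x => (∑ j : Fin 3, h N ^ (j : ℕ) • driftForm hn j x) a := by
      simp only [Finset.sum_apply, Pi.smul_apply, smul_eq_mul]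
      exact Finset.measurable_sum _ fun j _ =>
        ((measurable_pi_apply a).comp (hmeas j)).const_mul _
    exact this.comp_aemeasurable (hX i).aemeasurable
  have hsmm : ∀ N a, AEMeasurable (fun ω => sampleMoment T y N (1 - h N) ω a) P := by
    intro N a
    simp only [sampleMoment, Pi.smul_apply, Finset.sum_apply, smul_eq_mul]
    exact (Finset.aemeasurable_fun_sum _ fun i _ => hmcm N i a).const_mul _
  have hewm : ∀ N a b, AEMeasurable (fun ω => eickerWhite T y N (1 - h N) ω a b) P := by
    intro N a b
    simp only [eickerWhite, Matrix.smul_apply, Matrix.sum_apply, Matrix.vecMulVec_apply,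
      smul_eq_mul]
    exact (Finset.aemeasurable_fun_sum _ fun i _ => (hmcm N i a).mul (hmcm N i b)).const_mul _
  have hewl : ∀ᵐ ω ∂P, ∀ a b, Tendsto (fun N => eickerWhite T y N (1 - h N) ω a b) atTop
      (nhds (secondMomentMatrix (gaussianVector (T - 1) v) (driftForm hn 0) a b)) := by
    filter_upwards [ae_tendsto_sampleSecondMoment hX hind hmeas hL2 hlim] with ω hω a b
    convert hω a b using 2 with N
    simp only [eickerWhite, Matrix.smul_apply, Matrix.sum_apply, Matrix.vecMulVec_apply,
      smul_eq_mul, hmc]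
  have hsml : ∀ᵐ ω ∂P, ∀ a, Tendsto (fun N => sampleMoment T y N (1 - h N) ω a) atTop
      (nhds 0) := by
    filter_upwards [ae_tendsto_sampleMean hX hind hmeas
      (fun j a => (hL2 j a).integrable (by norm_num)) hlim] with ω hω a
    rw [← h0 a]
    convert hω a using 2 with N
    simp only [hm, Pi.smul_apply, Finset.sum_apply, smul_eq_mul]
  have hecl : ∀ᵐ ω ∂P, ∀ a b, Tendsto (fun N => eickerWhiteCentered T y N (1 - h N) ω a b) atTop
      (nhds (secondMomentMatrix (gaussianVector (T - 1) v) (driftForm hn 0) a b)) := by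
    filter_upwards [hewl, hsml] with ω hω hω' a b
    simp only [eickerWhiteCentered_apply]
    simpa using (hω a b).sub ((hω' a).mul (hω' b))
  have hcard : Fintype.card (MomentIdx (T - 1)) = T * (T - 1) / 2 - 2 := by
    rw [card_momentIdx hn, show T - 1 + 1 = T by omega]
  have hne : Nonempty (MomentIdx (T - 1)) :=
    ⟨⟨⟨(⟨1, by omega⟩, ⟨1, by omega⟩), le_rfl⟩, by simp⟩⟩
  have hδ : e ^ 4 * ((2 * (T : ℝ) - 3) * T * ((T : ℝ) - 1) * ((T : ℝ) - 2) / 72) = (e ^ 2) ^ 2 *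
      ((fun a => ∫ x, driftForm hn 2 x a ∂(gaussianVector (T - 1) v)) ⬝ᵥ
        (secondMomentMatrix (gaussianVector (T - 1) v) (driftForm hn 0))⁻¹ *ᵥ
          fun a => ∫ x, driftForm hn 2 x a ∂(gaussianVector (T - 1) v)) := by
    rw [noncentrality_eq hn hv, Nat.cast_sub (by omega)]
    push_cast
    ring
  rw [hδ, ← hcard]
  have hV := posDef_secondMomentMatrix_driftForm hn hv
  refine ⟨?_, ?_⟩
  · exact tendstoInDistribution_andersonRubin hX hind hmeas hL2 h0 h1 hV hlim hκ hewm hewl hm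
  · refine tendstoInDistribution_andersonRubin hX hind hmeas hL2 h0 h1 hV hlim hκ (fun N a b => ?_)
      hecl hm
    simp only [eickerWhiteCentered_apply]
    exact (hewm N a b).sub ((hsmm N a).mul (hsmm N b))
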